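/- Let $Q=\{x^2+y^2+z^2=1\}$ be the unit sphere in the affine part $\mathbb R^3$ of real projective 3-space. A line is a 2-secant if it meets $Q$ in two points; a point is interior if every line through it is a 2-secant. A gl star is a set $\mathcal S$ of 2-secants such that every point that is not interior lies on exactly one line of $\mathcal S$; it is topological if this line depends continuously on the point. Let $\Phi$ be the group of rotations about the $z$-axis $Z$. A gl star is rotational if it is $\Phi$-invariant, and it is in standard position if moreover it contains the $x$-axis $X$ (equivalently, all horizontal lines through the origin). Let $t,s:[0,\infty[\,\to[0,1[$ be homeomorphisms such that (1) $\displaystyle\lim_{0\neq a\to0}\frac{t(a)+s(a)}{2a}=1$; (2) $\displaystyle\frac{a^2}{a^2+1}-t(a)s(a)\ \ge\ (a^2+1)\Bigl(\frac{t(a)-s(a)}2\Bigr)^2$ for all $a>0$; (3) for all real $x,z$ with $x\ge 0$, $z\ne0$ and $x^2+z^2\ge1$, the map $$h_{x,z}(a)=(a^2+1)\bigl(x^2-1+(t(a)-s(a))z+t(a)s(a)\bigr)+1-x^2-z^2$$ has at most one positive root. Put $b(a)=(a^2+1)\frac{t(a)-s(a)}2$ and let $c(a)\ge0$ be given by $c(a)^2=a^2-(a^2+1)\bigl((\frac{t(a)+s(a)}2)^2+a^2(\frac{t(a)-s(a)}2)^2\bigr)$.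 For $a>0$ let $\Phi H_a$ be the cone (if $c(a)=0$) or hyperboloid (if $c(a)>0$) with equation $a^2(x^2+y^2)-(z-b(a))^2=c(a)^2$. A line on such a hyperboloid belongs to its right (left) regulus if, when it is traversed with increasing $z$, its projection to the $(x,y)$-plane is seen from the origin as moving counterclockwise (clockwise). For every $a>0$ with $c(a)\ne0$ choose the right or the left regulus of $\Phi H_a$, the choice being constant on every interval on which $c$ has no zero. Then the set $\mathcal S$ consisting of $Z$, of all lines of the orbit $\Phi X$, of all lines contained in the cones $\Phi H_a$ with $c(a)=0$, and of the lines of the chosen reguli for $c(a)\neq0$, is a topological rotational gl star. Conversely, every topological rotational gl star in standard position is obtained in this way for suitable $t$, $s$ satisfying (1)-(3) and a suitable choice of reguli. -/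

import Mathlib

open Set Filter Topology Module
open scoped NNReal

noncomputable section

namespace GLStar

/-- Homogeneous coordinates `(x, y, z, w)` for real projective 3-space; the affine part `ℝ³` is
`w ≠ 0`, the point `(x, y, z)` of `ℝ³` being spanned by `(x, y, z, 1)`. -/
abbrev V : Type := EuclideanSpace ℝ (Fin 4)

/-- The `k`-dimensional linear subspaces of `ℝ⁴` (a Grassmann manifold). -/
def Grass (k : ℕ) : Type := {U : Submodule ℝ V // finrank ℝ U = k}

/-- The usual topology of the Grassmann manifold: a subspace is identified with the orthogonal
projection onto it. -/
instance (k : ℕ) : TopologicalSpace (Grass k) :=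
  TopologicalSpace.induced (fun U : Grass k => (U.1.starProjection : V →L[ℝ] V)) inferInstance

/-- Points of projective 3-space. -/
abbrev Point : Type := Grass 1

/-- Lines of projective 3-space. -/
abbrev Line : Type := Grass 2

/-- Incidence of points and lines. -/
def Incident (p : Point) (L : Line) : Prop := p.1 ≤ L.1

/-- The elliptic quadric `Q`, i.e. the unit sphere `x² + y² + z² = 1` of the affine part. -/
def sphere : Set Point := {p | ∀ v ∈ p.1, v 0 ^ 2 + v 1 ^ 2 + v 2 ^ 2 = v 3 ^ 2}

/-- A line is a 2-secant if it meets the sphere in exactly two points. -/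
def IsTwoSecant (L : Line) : Prop := {p : Point | p ∈ sphere ∧ Incident p L}.ncard = 2

/-- A point is interior if every line through it is a 2-secant. -/
def IsInterior (p : Point) : Prop := ∀ L : Line, Incident p L → IsTwoSecant L

/-- Generalized line stars with respect to the unit sphere: all lines of `S` are 2-secants, and
every point that is not interior is incident with precisely one line of `S`. -/
structure IsGLStar (S : Set Line) : Prop where
  twoSecant : ∀ L ∈ S, IsTwoSecant L
  existsUnique : ∀ p : Point, ¬ IsInterior p → ∃! L : Line, L ∈ S ∧ Incident p L

/-- A gl star is topological if the line of `S` containing a given non-interior point depends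
continuously on that point. -/
def IsTopological (S : Set Line) : Prop :=
  ∃ f : {p : Point // ¬ IsInterior p} → Line,
    Continuous f ∧ ∀ p, f p ∈ S ∧ Incident p.1 (f p)

/-- The rotation of `ℝ³` through the angle `θ` about the `z`-axis, in homogeneous coordinates. -/
def rot (θ : ℝ) : V →ₗ[ℝ] V where
  toFun v := !₂[Real.cos θ * v 0 - Real.sin θ * v 1, Real.sin θ * v 0 + Real.cos θ * v 1, v 2, v 3]
  map_add' u v := by
    ext i; fin_cases i <;> simp <;> ring
  map_smul' c v := by
    ext i; fin_cases i <;> simp <;> ring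

theorem rot_injective (θ : ℝ) : Function.Injective (rot θ) := by
  intro u v h
  have h0 : Real.cos θ * u 0 - Real.sin θ * u 1 = Real.cos θ * v 0 - Real.sin θ * v 1 := by
    simpa [rot] using congrArg (fun w : V => w 0) h
  have h1 : Real.sin θ * u 0 + Real.cos θ * u 1 = Real.sin θ * v 0 + Real.cos θ * v 1 := by
    simpa [rot] using congrArg (fun w : V => w 1) h
  have h2 : u 2 = v 2 := by simpa [rot] using congrArg (fun w : V => w 2) h
  have h3 : u 3 = v 3 := by simpa [rot] using congrArg (fun w : V => w 3) h
  have hs := Real.sin_sq_add_cos_sq θ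
  ext i
  fin_cases i
  · show u 0 = v 0
    linear_combination Real.cos θ * h0 + Real.sin θ * h1 - (u 0 - v 0) * hs
  · show u 1 = v 1
    linear_combination Real.cos θ * h1 - Real.sin θ * h0 - (u 1 - v 1) * hs
  · exact h2
  · exact h3

/-- The image of a line under the rotation through `θ` about the `z`-axis. -/
def rotLine (θ : ℝ) (L : Line) : Line :=
  ⟨L.1.map (rot θ), by
    rw [← (Submodule.equivMapOfInjective (rot θ) (rot_injective θ) L.1).finrank_eq]
    exact L.2⟩

/-- `S` is invariant under the group `Φ` of rotations about the `z`-axis. -/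
def IsRotational (S : Set Line) : Prop := ∀ θ : ℝ, ∀ L ∈ S, rotLine θ L ∈ S

/-- The projective line joining the affine point `q` to the point at infinity in direction `d`. -/
def affineLine (q d : Fin 3 → ℝ) (hd : d ≠ 0) : Line :=
  ⟨Submodule.span ℝ (Set.range ![(!₂[q 0, q 1, q 2, 1] : V), !₂[d 0, d 1, d 2, 0]]), by
    rw [finrank_span_eq_card]
    · simp
    · rw [LinearIndependent.pair_iff]
      intro α β hαβ
      have h3 : α = 0 := by simpa using congrArg (fun w : V => w 3) hαβ
      subst h3
      refine ⟨rfl, ?_⟩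
      by_contra hβ
      apply hd
      have h0 : β * d 0 = 0 := by simpa using congrArg (fun w : V => w 0) hαβ
      have h1 : β * d 1 = 0 := by simpa using congrArg (fun w : V => w 1) hαβ
      have h2 : β * d 2 = 0 := by simpa using congrArg (fun w : V => w 2) hαβ
      funext i
      fin_cases i
      · exact (mul_eq_zero.mp h0).resolve_left hβ
      · exact (mul_eq_zero.mp h1).resolve_left hβ
      · exact (mul_eq_zero.mp h2).resolve_left hβ⟩

/-- The `x`-axis `X`. -/
def xAxis : Line := affineLine 0 ![1, 0, 0] (by simp)

/-- The `z`-axis `Z`. -/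
def zAxis : Line := affineLine 0 ![0, 0, 1] (by simp)

/-- The line `L` is contained in the (projective closure of the) cone or hyperboloid `Φ H_a`
obtained by rotating the line pair or hyperbola `H_a : a² x² - (z - b)² = c²` of the
`(x, z)`-plane about the `z`-axis. -/
def InSurface (a b c : ℝ) (L : Line) : Prop :=
  ∀ v ∈ L.1, a ^ 2 * (v 0 ^ 2 + v 1 ^ 2) - (v 2 - b * v 3) ^ 2 = c ^ 2 * v 3 ^ 2

/-- Along `L`, parametrized as `q + τ d` with increasing third coordinate, the lines joining the
origin of the `(x, y)`-plane to the projected point rotate counterclockwise if `ε = 1`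
(`x y' - y x' > 0`) and clockwise if `ε = -1`. The lines with `ε = 1` contained in one of the
hyperboloids above form its right regulus, the lines with `ε = -1` its left regulus. -/
def HasOrientation (ε : ℤˣ) (L : Line) : Prop :=
  ∃ (q d : Fin 3 → ℝ) (hd : d ≠ 0), L = affineLine q d hd ∧ 0 < d 2 ∧
    0 < ((ε : ℤ) : ℝ) * (q 0 * d 1 - q 1 * d 0)

/-- The set of lines built from the family `H_a`, `a > 0`: the axis `Z`, the orbit `Φ X`, all lines
contained in the cones `Φ H_a` with `c a = 0`, and from each hyperboloid `Φ H_a` with `c a ≠ 0` the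
right or left regulus according to the sign `ε a`. -/
def star (b c : ℝ≥0 → ℝ) (ε : ℝ≥0 → ℤˣ) : Set Line :=
  {L | L = zAxis ∨ (∃ θ : ℝ, L = rotLine θ xAxis) ∨
    ∃ a : ℝ≥0, 0 < a ∧ InSurface a (b a) (c a) L ∧ (c a = 0 ∨ HasOrientation (ε a) L)}

/-- The choice of reguli is admissible if it is constant on every interval of positive parameters
on which `c` has no zero. -/
def AdmissibleChoice (c : ℝ≥0 → ℝ) (ε : ℝ≥0 → ℤˣ) : Prop :=
  ∀ a₁ a₂ : ℝ≥0, 0 < a₁ → a₁ ≤ a₂ → (∀ a ∈ Icc a₁ a₂, c a ≠ 0) → ε a₁ = ε a₂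

/-- `b(a) = (a² + 1) (t - s) / 2`. -/
def coeffB (t s : ℝ≥0 ≃ₜ Ico (0 : ℝ) 1) (a : ℝ≥0) : ℝ :=
  ((a : ℝ) ^ 2 + 1) * (((t a : ℝ) - s a) / 2)

/-- `c(a) ≥ 0` with `c(a)² = a² - (a² + 1) (((t + s) / 2)² + a² ((t - s) / 2)²)`. -/
def coeffC (t s : ℝ≥0 ≃ₜ Ico (0 : ℝ) 1) (a : ℝ≥0) : ℝ :=
  √((a : ℝ) ^ 2 - ((a : ℝ) ^ 2 + 1) *
    ((((t a : ℝ) + s a) / 2) ^ 2 + (a : ℝ) ^ 2 * (((t a : ℝ) - s a) / 2) ^ 2))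

/-- The map `h_{x,z}`. -/
def h (t s : ℝ≥0 ≃ₜ Ico (0 : ℝ) 1) (x z : ℝ) (a : ℝ≥0) : ℝ :=
  ((a : ℝ) ^ 2 + 1) * (x ^ 2 - 1 + ((t a : ℝ) - s a) * z + (t a : ℝ) * s a) + 1 - x ^ 2 - z ^ 2

theorem h_eq (t s : ℝ≥0 ≃ₜ Ico (0 : ℝ) 1) (x z : ℝ) (a : ℝ≥0) :
    h t s x z a = (a : ℝ) ^ 2 * (x ^ 2 + z ^ 2 - 1)
      + ((a : ℝ) ^ 2 + 1) * ((t a : ℝ) - z) * ((s a : ℝ) + z) := by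
  unfold h; ring

/-- The conditions imposed on the homeomorphisms `t, s : [0, ∞) → [0, 1)`. -/
structure AdmissiblePair (t s : ℝ≥0 ≃ₜ Ico (0 : ℝ) 1) : Prop where
  tendsto : Tendsto (fun a : ℝ≥0 => ((t a : ℝ) + s a) / (2 * (a : ℝ))) (𝓝[≠] 0) (𝓝 1)
  ineq : ∀ a : ℝ≥0, 0 < a →
    ((a : ℝ) ^ 2 + 1) * (((t a : ℝ) - s a) / 2) ^ 2
      ≤ (a : ℝ) ^ 2 / ((a : ℝ) ^ 2 + 1) - (t a : ℝ) * s a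
  root : ∀ x z : ℝ, 0 ≤ x → z ≠ 0 → 1 ≤ x ^ 2 + z ^ 2 →
    {a : ℝ≥0 | 0 < a ∧ h t s x z a = 0}.Subsingleton

end GLStar

end

/-! Every non-vertical, non-horizontal line off the plane at infinity is a rotated copy of `gen a b
g`, the line through `(g, 0, b)` with direction `(0, 1, a)`, `a > 0`. Its orbit sweeps out `a²(x² +
y²) - (z - b)² = a²g²`. Hence `c = a|g|`, and the sign of `g` records the regulus. By
`star_eq_rotStar` and `exists_eq_rotStar`, both sides of the theorem become statements about
`rotStar b g`, a curve of lines rotated about `Z`.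

The function `h_{x,z}(a)` is the difference of the two sides of the surface equation at `(x, z)`
(`h_eq_surface`). On the sphere it factors as `(a² + 1)(t - z)(s + z)`, so the lines with parameter
`a` meet the sphere at heights `t(a)` and `-s(a)`.

From `t, s` to a star: off the axis, a root of `h` exists by the intermediate value theorem, and (3)
makes it unique. On the axis outside the ball there must be no root, which follows from (3) by
perturbation (`h_axis_ne_zero`). The lines are 2-secants because their traces in `z = 0` lie inside
the sphere (`AdmissiblePair.sq_add_sq`). For continuity it suffices that the star is compact
(`isTopological_of_isCompact`): condition (1) makes `g` continuous at `0`, and the lines tend to `Z`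
as `a → ∞`.

From a star to `t, s`: the lines through the points at infinity give `b` and `g`, which are
continuous because the traces in `z = 0` are bounded. Each sphere point lies on exactly one line, so
the heights of the intersections with the sphere are homeomorphisms onto `[0, 1)`
(`exists_homeomorph`). Their sum and difference recover `b` and `c`, and (1)-(3) are read off in
`exists_admissiblePair`. -/

noncomputable section

namespace GLStar

/-! ### Points, lines and rotations in homogeneous coordinates. -/

/-- The point of projective space spanned by a nonzero vector. -/
def pt (v : V) (hv : v ≠ 0) : Point := ⟨Submodule.span ℝ {v}, finrank_span_singleton hv⟩

theorem incident_pt {v : V} (hv : v ≠ 0) {L : Line} : Incident (pt v hv) L ↔ v ∈ L.1 := by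
  simp [Incident, pt, Submodule.span_singleton_le_iff_mem]

theorem exists_eq_pt (p : Point) : ∃ (v : V) (hv : v ≠ 0), p = pt v hv := by
  obtain ⟨⟨v, hvp⟩, hv, h⟩ := finrank_eq_one_iff'.1 p.2
  refine ⟨v, fun h0 => hv (Subtype.ext h0), Subtype.ext ?_⟩
  apply le_antisymm
  · intro w hw
    obtain ⟨c, hc⟩ := h ⟨w, hw⟩
    exact Submodule.mem_span_singleton.2 ⟨c, congrArg Subtype.val hc⟩
  · exact (Submodule.span_singleton_le_iff_mem _ _).2 hvp

theorem pt_eq_pt_iff {u v : V} (hu : u ≠ 0) (hv : v ≠ 0) :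
    pt u hu = pt v hv ↔ ∃ c : ℝ, u = c • v := by
  constructor
  · intro h
    have : u ∈ Submodule.span ℝ {v} := by
      have h' : Submodule.span ℝ {u} = Submodule.span ℝ {v} := congrArg Subtype.val h
      rw [← h']; exact Submodule.mem_span_singleton_self u
    obtain ⟨c, hc⟩ := Submodule.mem_span_singleton.1 this
    exact ⟨c, hc.symm⟩
  · rintro ⟨c, rfl⟩
    have hc : c ≠ 0 := fun h => hu (by simp [h])
    exact Subtype.ext (Submodule.span_singleton_smul_eq (IsUnit.mk0 c hc) v)

theorem line_eq_of_le {L M : Line} (h : L.1 ≤ M.1) : L = M :=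
  Subtype.ext (Submodule.eq_of_le_of_finrank_eq h (L.2.trans M.2.symm))

theorem line_eq_of_mem {L M : Line} {u v : V} (hi : LinearIndependent ℝ ![u, v])
    (huL : u ∈ L.1) (hvL : v ∈ L.1) (huM : u ∈ M.1) (hvM : v ∈ M.1) : L = M := by
  have hf : finrank ℝ (Submodule.span ℝ (Set.range ![u, v])) = 2 := by
    simpa using finrank_span_eq_card hi
  have key : ∀ N : Line, u ∈ N.1 → v ∈ N.1 → (⟨_, hf⟩ : Line) = N := by
    intro N hu hv
    apply line_eq_of_le
    rw [Submodule.span_le]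
    rintro _ ⟨i, rfl⟩
    fin_cases i
    · exact hu
    · exact hv
  exact (key L huL hvL).symm.trans (key M huM hvM)

/-- A line contains a nonzero vector in the kernel of any linear form. -/
theorem exists_mem_ker (L : Line) (φ : V →ₗ[ℝ] ℝ) : ∃ v ∈ L.1, v ≠ 0 ∧ φ v = 0 := by
  have h2 : finrank ℝ L.1 = 2 := L.2
  have hk : (φ.domRestrict L.1).ker ≠ ⊥ := by
    apply LinearMap.ker_ne_bot_of_finrank_lt
    rw [h2]; simp
  obtain ⟨⟨v, hv⟩, hvk, hv0⟩ := Submodule.exists_mem_ne_zero_of_ne_bot hk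
  exact ⟨v, hv, fun h => hv0 (Subtype.ext h), by simpa using hvk⟩

/-- Coordinate functions as continuous linear forms. -/
abbrev coord (i : Fin 4) : V →L[ℝ] ℝ := EuclideanSpace.proj i

theorem exists_mem_coord_eq_zero (L : Line) (i : Fin 4) : ∃ v ∈ L.1, v ≠ 0 ∧ v i = 0 := by
  simpa using exists_mem_ker L (coord i).toLinearMap

theorem eq_zero_iff (v : V) : v = 0 ↔ v 0 = 0 ∧ v 1 = 0 ∧ v 2 = 0 ∧ v 3 = 0 := by
  constructor
  · rintro rfl; simp
  · rintro ⟨h0, h1, h2, h3⟩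
    ext i; fin_cases i <;> simpa

theorem mem_affineLine {q d : Fin 3 → ℝ} {hd : d ≠ 0} {v : V} :
    v ∈ (affineLine q d hd).1 ↔ ∃ τ : ℝ, v 0 = v 3 * q 0 + τ * d 0 ∧ v 1 = v 3 * q 1 + τ * d 1 ∧
      v 2 = v 3 * q 2 + τ * d 2 := by
  have hr : Set.range ![(!₂[q 0, q 1, q 2, 1] : V), !₂[d 0, d 1, d 2, 0]] =
      {!₂[q 0, q 1, q 2, 1], !₂[d 0, d 1, d 2, 0]} := by
    exact Matrix.range_cons_cons_empty _ _ _
  simp only [affineLine, hr, Submodule.mem_span_pair]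
  constructor
  · rintro ⟨α, β, rfl⟩
    exact ⟨β, by simp⟩
  · rintro ⟨τ, h0, h1, h2⟩
    refine ⟨v 3, τ, ?_⟩
    ext i; fin_cases i <;> simp [h0, h1, h2]

theorem mem_zAxis {v : V} : v ∈ zAxis.1 ↔ v 0 = 0 ∧ v 1 = 0 := by
  simp [zAxis, mem_affineLine]

theorem mem_xAxis {v : V} : v ∈ xAxis.1 ↔ v 1 = 0 ∧ v 2 = 0 := by
  simp [xAxis, mem_affineLine]

theorem mem_rotLine {θ : ℝ} {L : Line} {v : V} :
    v ∈ (rotLine θ L).1 ↔ (!₂[Real.cos θ * v 0 + Real.sin θ * v 1,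
      -Real.sin θ * v 0 + Real.cos θ * v 1, v 2, v 3] : V) ∈ L.1 := by
  have hs := Real.sin_sq_add_cos_sq θ
  simp only [rotLine, Submodule.mem_map]
  constructor
  · rintro ⟨u, hu, rfl⟩
    convert hu using 1
    ext i
    fin_cases i <;> simp [rot]
    · linear_combination u 0 * hs
    · linear_combination u 1 * hs
  · intro h
    refine ⟨_, h, ?_⟩
    ext i
    fin_cases i <;> simp [rot]
    · linear_combination v 0 * hs
    · linear_combination v 1 * hs

theorem rotLine_rotLine (θ η : ℝ) (L : Line) : rotLine θ (rotLine η L) = rotLine (θ + η) L := by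
  apply line_eq_of_le
  intro v hv
  rw [mem_rotLine, mem_rotLine] at hv
  rw [mem_rotLine]
  convert hv using 1
  ext i
  fin_cases i <;> simp [Real.cos_add, Real.sin_add] <;> ring

theorem rotLine_zero (L : Line) : rotLine 0 L = L := by
  apply line_eq_of_le
  intro v hv
  rw [mem_rotLine] at hv
  convert hv using 1
  ext i; fin_cases i <;> simp

theorem rotLine_zAxis (θ : ℝ) : rotLine θ zAxis = zAxis := by
  symm
  apply line_eq_of_le
  intro v hv
  rw [mem_zAxis] at hv
  rw [mem_rotLine, mem_zAxis]
  simp [hv.1, hv.2]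

/-! ### Normal form of lines up to rotation, and the surfaces they sweep out. -/

/-- The line through the affine point `(g, 0, b)` with direction `(0, 1, a)`. -/
def gen (a b g : ℝ) : Line :=
  affineLine ![g, 0, b] ![0, 1, a] (fun h => by simpa using congrFun h 1)

theorem mem_gen {a b g : ℝ} {v : V} :
    v ∈ (gen a b g).1 ↔ v 0 = g * v 3 ∧ v 2 = b * v 3 + a * v 1 := by
  simp only [gen, mem_affineLine]
  constructor
  · rintro ⟨τ, h0, h1, h2⟩
    simp at h0 h1 h2
    exact ⟨by rw [h0]; ring, by rw [h2, h1]; ring⟩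
  · rintro ⟨h0, h2⟩
    exact ⟨v 1, by simp [h0]; ring, by simp, by simp [h2]; ring⟩

theorem mem_rotLine_gen {θ a b g : ℝ} {v : V} :
    v ∈ (rotLine θ (gen a b g)).1 ↔ Real.cos θ * v 0 + Real.sin θ * v 1 = g * v 3 ∧
      v 2 = b * v 3 + a * (-Real.sin θ * v 0 + Real.cos θ * v 1) := by
  rw [mem_rotLine, mem_gen]; simp

/-- The quadratic equation of the surface swept out by `gen a b g`. -/
def OnSurface (a b g : ℝ) (v : V) : Prop :=
  a ^ 2 * (v 0 ^ 2 + v 1 ^ 2) - (v 2 - b * v 3) ^ 2 = (a * g * v 3) ^ 2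

theorem onSurface_of_mem {θ a b g : ℝ} {v : V} (h : v ∈ (rotLine θ (gen a b g)).1) :
    OnSurface a b g v := by
  obtain ⟨h1, h2⟩ := mem_rotLine_gen.1 h
  have hs := Real.sin_sq_add_cos_sq θ
  have h3 : a * g * v 3 = a * (Real.cos θ * v 0 + Real.sin θ * v 1) := by rw [h1]; ring
  have h4 : v 2 - b * v 3 = a * (-Real.sin θ * v 0 + Real.cos θ * v 1) := by rw [h2]; ring
  unfold OnSurface
  rw [h3, h4]
  linear_combination -a ^ 2 * (v 0 ^ 2 + v 1 ^ 2) * hs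

theorem exists_cos_sin {x y : ℝ} (h : x ^ 2 + y ^ 2 = 1) :
    ∃ θ : ℝ, Real.cos θ = x ∧ Real.sin θ = y := by
  have hn : ‖(⟨x, y⟩ : ℂ)‖ = 1 := by
    rw [Complex.norm_def, Complex.normSq_mk, ← pow_two, ← pow_two, h, Real.sqrt_one]
  obtain ⟨θ, hθ⟩ := (Complex.norm_eq_one_iff _).1 hn
  refine ⟨θ, ?_, ?_⟩
  · simpa [Complex.exp_ofReal_mul_I_re] using congrArg Complex.re hθ
  · simpa [Complex.exp_ofReal_mul_I_im] using congrArg Complex.im hθ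

/-- Two plane vectors of the same length differ by a rotation. -/
theorem exists_rotation {x y p r : ℝ} (h : x ^ 2 + y ^ 2 = p ^ 2 + r ^ 2) :
    ∃ θ : ℝ, Real.cos θ * x + Real.sin θ * y = p ∧ -Real.sin θ * x + Real.cos θ * y = r := by
  by_cases h0 : x ^ 2 + y ^ 2 = 0
  · have hx : x = 0 := by nlinarith [sq_nonneg x, sq_nonneg y]
    have hy : y = 0 := by nlinarith [sq_nonneg x, sq_nonneg y]
    have hp : p = 0 := by nlinarith [sq_nonneg p, sq_nonneg r]
    have hr : r = 0 := by nlinarith [sq_nonneg p, sq_nonneg r]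
    exact ⟨0, by simp [*], by simp [*]⟩
  · obtain ⟨θ, hc, hs⟩ := exists_cos_sin (x := (x * p + y * r) / (x ^ 2 + y ^ 2))
      (y := (y * p - x * r) / (x ^ 2 + y ^ 2)) (by
        field_simp
        linear_combination -(x ^ 2 + y ^ 2) * h)
    refine ⟨θ, ?_, ?_⟩ <;> rw [hc, hs] <;> field_simp <;> ring

/-- Every point of the surface is on some rotated copy of `gen a b g`. -/
theorem exists_mem_rotLine_gen {a b g : ℝ} (ha : a ≠ 0 ∨ b = 0 ∧ g = 0) {v : V}
    (h : OnSurface a b g v) : ∃ θ, v ∈ (rotLine θ (gen a b g)).1 := by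
  unfold OnSurface at h
  by_cases h0 : a = 0
  -- The surface is now the plane `z = 0`; it is covered because `g = 0` makes the lines pass
  -- through its centre.
  · obtain ⟨hb, hg⟩ := ha.resolve_left (not_not.2 h0)
    subst h0 hb hg
    have h2 : v 2 = 0 := by
      have : v 2 ^ 2 = 0 := by linear_combination -h
      exact pow_eq_zero_iff two_ne_zero |>.1 this
    obtain ⟨θ, hθ, -⟩ := exists_rotation (x := v 0) (y := v 1) (p := 0)
      (r := √(v 0 ^ 2 + v 1 ^ 2)) (by rw [Real.sq_sqrt (by positivity)]; ring)
    exact ⟨θ, mem_rotLine_gen.2 ⟨by simpa using hθ, by simpa using h2⟩⟩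
  · obtain ⟨θ, h1, h2⟩ := exists_rotation (x := v 0) (y := v 1) (p := g * v 3)
      (r := (v 2 - b * v 3) / a) (by field_simp; linear_combination h)
    exact ⟨θ, mem_rotLine_gen.2 ⟨h1, by rw [h2]; field_simp; ring⟩⟩

theorem direction_mem_rotLine_gen (θ a b g : ℝ) :
    (!₂[-Real.sin θ, Real.cos θ, a, 0] : V) ∈ (rotLine θ (gen a b g)).1 := by
  rw [mem_rotLine_gen]
  constructor
  · simp; ring
  · simp; linear_combination -a * Real.sin_sq_add_cos_sq θ

/-- The parameter `a` is determined by the line. -/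
theorem slope_eq {θ η a b g a' b' g' : ℝ} (ha : 0 ≤ a) (ha' : 0 ≤ a')
    (h : rotLine θ (gen a b g) = rotLine η (gen a' b' g')) : a = a' := by
  have hm := direction_mem_rotLine_gen θ a b g
  rw [h] at hm
  have e := onSurface_of_mem hm
  simp [OnSurface] at e
  have : a ^ 2 = a' ^ 2 := by linear_combination -e
  exact (pow_left_inj₀ ha ha' two_ne_zero).1 this

theorem zAxis_ne_rotLine_gen {θ a b g : ℝ} : zAxis ≠ rotLine θ (gen a b g) := by
  intro h
  have hm := direction_mem_rotLine_gen θ a b g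
  rw [← h, mem_zAxis] at hm
  have h0 : Real.sin θ = 0 := by simpa using hm.1
  have h1 : Real.cos θ = 0 := by simpa using hm.2
  simpa [h0, h1] using Real.sin_sq_add_cos_sq θ

/-- Two rotated copies of `gen a b g` through a point off the axis `Z` coincide. -/
theorem rotLine_gen_eq_of_mem {θ η a b g : ℝ} (ha : a ≠ 0 ∨ b = 0 ∧ g = 0) {v : V}
    (hv : v 0 ≠ 0 ∨ v 1 ≠ 0) (h : v ∈ (rotLine θ (gen a b g)).1)
    (h' : v ∈ (rotLine η (gen a b g)).1) : rotLine θ (gen a b g) = rotLine η (gen a b g) := by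
  rw [mem_rotLine_gen] at h h'
  obtain ⟨h1, h2⟩ := h
  obtain ⟨h1', h2'⟩ := h'
  have hn : v 0 ^ 2 + v 1 ^ 2 ≠ 0 := by
    rcases hv with hv | hv <;> positivity
  apply line_eq_of_le
  intro u hu
  rw [mem_rotLine_gen] at hu ⊢
  obtain ⟨hu1, hu2⟩ := hu
  -- Horizontal case: both lines pass through the origin, and `u`, `v` have horizontal parts
  -- proportional to the same direction.
  by_cases h0 : a = 0
  · obtain ⟨hb, hg⟩ := ha.resolve_left (not_not.2 h0)
    subst h0 hb hg
    refine ⟨?_, by simpa using hu2⟩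
    have hs := Real.sin_sq_add_cos_sq θ
    simp only [zero_mul] at *
    have e1 : v 0 = -Real.sin θ * (-Real.sin θ * v 0 + Real.cos θ * v 1) := by
      linear_combination Real.cos θ * h1 - v 0 * hs
    have e2 : v 1 = Real.cos θ * (-Real.sin θ * v 0 + Real.cos θ * v 1) := by
      linear_combination Real.sin θ * h1 - v 1 * hs
    have e3 : u 0 = -Real.sin θ * (-Real.sin θ * u 0 + Real.cos θ * u 1) := by
      linear_combination Real.cos θ * hu1 - u 0 * hs
    have e4 : u 1 = Real.cos θ * (-Real.sin θ * u 0 + Real.cos θ * u 1) := by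
      linear_combination Real.sin θ * hu1 - u 1 * hs
    set ρ := -Real.sin θ * v 0 + Real.cos θ * v 1
    set σ := -Real.sin θ * u 0 + Real.cos θ * u 1
    have hρ : ρ ≠ 0 := by
      intro h0; apply hn; rw [e1, e2, h0]; simp
    apply mul_left_cancel₀ hρ
    rw [e3, e4]
    rw [e1, e2] at h1'
    linear_combination σ * h1'
  -- For `a ≠ 0` the two back-rotations agree on the nonzero plane vector `(v 0, v 1)`, so they have
  -- the same sine and cosine.
  · have e1 : -Real.sin θ * v 0 + Real.cos θ * v 1 = -Real.sin η * v 0 + Real.cos η * v 1 := by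
      apply mul_left_cancel₀ h0
      linear_combination h2' - h2
    have e2 : Real.cos θ * v 0 + Real.sin θ * v 1 = Real.cos η * v 0 + Real.sin η * v 1 :=
      h1.trans h1'.symm
    have hc : Real.cos θ = Real.cos η := by
      apply mul_left_cancel₀ hn
      linear_combination v 0 * e2 + v 1 * e1
    have hs : Real.sin θ = Real.sin η := by
      apply mul_left_cancel₀ hn
      linear_combination v 1 * e2 - v 0 * e1
    rw [← hc, ← hs]
    exact ⟨hu1, hu2⟩

/-- A line with a point at infinity off the axis and off the plane `z = 0`, not contained in the
plane at infinity, is a rotated copy of some `gen a b g`. -/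
theorem exists_eq_rotLine_gen {L : Line} {d : V} (hd : d ∈ L.1) (hd3 : d 3 = 0) (hd2 : d 2 ≠ 0)
    (hd01 : d 0 ≠ 0 ∨ d 1 ≠ 0) {w : V} (hw : w ∈ L.1) (hw3 : w 3 ≠ 0) :
    ∃ θ a b g : ℝ, 0 < a ∧ L = rotLine θ (gen a b g) := by
  have hn : 0 < d 0 ^ 2 + d 1 ^ 2 := by
    rcases hd01 with h | h <;> positivity
  -- The direction `d` matters only up to a scalar; the sign of `ρ` is chosen to make the slope
  -- positive.
  obtain ⟨ρ, hρ0, hρ⟩ : ∃ ρ : ℝ, ρ ≠ 0 ∧ ρ ^ 2 = d 0 ^ 2 + d 1 ^ 2 ∧ 0 < d 2 / ρ := by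
    have h1 := Real.sqrt_pos.2 hn
    have h2 := Real.sq_sqrt hn.le
    rcases lt_or_gt_of_ne hd2 with h | h
    · exact ⟨-√(d 0 ^ 2 + d 1 ^ 2), by simpa using h1.ne', by rw [neg_sq, h2],
        div_pos_of_neg_of_neg h (by simpa using h1)⟩
    · exact ⟨√(d 0 ^ 2 + d 1 ^ 2), h1.ne', h2, div_pos h h1⟩
  obtain ⟨hρ2, ha⟩ := hρ
  obtain ⟨θ, hc, hs⟩ := exists_cos_sin (x := d 1 / ρ) (y := - d 0 / ρ) (by
    field_simp; linear_combination -hρ2)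
  have hc' : d 1 = ρ * Real.cos θ := by rw [hc]; field_simp
  have hs' : d 0 = -ρ * Real.sin θ := by rw [hs]; field_simp
  have hsc := Real.sin_sq_add_cos_sq θ
  refine ⟨θ, d 2 / ρ, (w 2 - d 2 / ρ * (-Real.sin θ * w 0 + Real.cos θ * w 1)) / w 3,
    (Real.cos θ * w 0 + Real.sin θ * w 1) / w 3, ha, ?_⟩
  refine line_eq_of_mem (u := w) (v := d) ?_ hw hd ?_ ?_
  · rw [LinearIndependent.pair_iff]
    intro α β h
    have h3 : α = 0 := by
      have : α * w 3 + β * d 3 = 0 := by simpa using congrArg (fun u : V => u 3) h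
      rw [hd3, mul_zero, add_zero] at this
      exact (mul_eq_zero.1 this).resolve_right hw3
    refine ⟨h3, ?_⟩
    have : α * w 2 + β * d 2 = 0 := by simpa using congrArg (fun u : V => u 2) h
    rw [h3, zero_mul, zero_add] at this
    exact (mul_eq_zero.1 this).resolve_right hd2
  · rw [mem_rotLine_gen]
    constructor <;> field_simp
    ring
  · rw [mem_rotLine_gen, hd3, hc', hs']
    constructor
    · ring
    · field_simp
      linear_combination -d 2 * ρ * w 3 * hsc

theorem exists_eq_comb {L : Line} {u v : V} (hi : LinearIndependent ℝ ![u, v])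
    (hu : u ∈ L.1) (hv : v ∈ L.1) {x : V} (hx : x ∈ L.1) : ∃ α β : ℝ, x = α • u + β • v := by
  have hf : finrank ℝ (Submodule.span ℝ (Set.range ![u, v])) = 2 := by
    simpa using finrank_span_eq_card hi
  have h : (⟨_, hf⟩ : Line) = L :=
    line_eq_of_mem hi (Submodule.subset_span ⟨0, rfl⟩) (Submodule.subset_span ⟨1, rfl⟩) hu hv
  rw [← h] at hx
  change x ∈ Submodule.span ℝ (Set.range ![u, v]) at hx
  rw [Matrix.range_cons_cons_empty, Submodule.mem_span_pair] at hx
  obtain ⟨α, β, h⟩ := hx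
  exact ⟨α, β, h.symm⟩

/-! ### The sphere, 2-secants and interior points. -/

/-- The quadratic form defining the unit sphere. -/
def Q (v : V) : ℝ := v 0 ^ 2 + v 1 ^ 2 + v 2 ^ 2 - v 3 ^ 2

theorem pt_mem_sphere {v : V} (hv : v ≠ 0) : pt v hv ∈ sphere ↔ Q v = 0 := by
  constructor
  · intro h
    have := h v (Submodule.mem_span_singleton_self v)
    unfold Q; linarith
  · intro h w hw
    obtain ⟨c, rfl⟩ := Submodule.mem_span_singleton.1 hw
    unfold Q at h
    simp only [PiLp.smul_apply, smul_eq_mul]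
    linear_combination c ^ 2 * h

theorem linearIndependent_of_coord {v w : V} (hv : v 3 ≠ 0) (hw : w 3 = 0) (hw0 : w ≠ 0) :
    LinearIndependent ℝ ![v, w] := by
  rw [LinearIndependent.pair_iff]
  intro α β h
  have h3 : α * v 3 + β * w 3 = 0 := by simpa using congrArg (fun u : V => u 3) h
  rw [hw, mul_zero, add_zero] at h3
  have hα := (mul_eq_zero.1 h3).resolve_right hv
  refine ⟨hα, ?_⟩
  rw [hα, zero_smul, zero_add] at h
  exact (smul_eq_zero.1 h).resolve_right hw0

/-- A line containing an inner point of the sphere is a 2-secant. -/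
theorem isTwoSecant_of_neg {L : Line} {v : V} (hv : v ∈ L.1) (hQ : Q v < 0) : IsTwoSecant L := by
  have hv3 : v 3 ≠ 0 := by
    intro h
    unfold Q at hQ
    rw [h] at hQ
    nlinarith [sq_nonneg (v 0), sq_nonneg (v 1), sq_nonneg (v 2)]
  -- With `w` the point at infinity of `L`, `Q (v + β w)` is a quadratic in `β` with positive
  -- leading and negative constant coefficient, hence has two roots.
  obtain ⟨w, hw, hw0, hw3⟩ := exists_mem_coord_eq_zero L 3
  have hi := linearIndependent_of_coord hv3 hw3 hw0
  obtain ⟨n, hn⟩ : ∃ n, n = w 0 ^ 2 + w 1 ^ 2 + w 2 ^ 2 := ⟨_, rfl⟩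
  obtain ⟨m, hm⟩ : ∃ m, m = v 0 * w 0 + v 1 * w 1 + v 2 * w 2 := ⟨_, rfl⟩
  have hnpos : 0 < n := by
    have h0 : 0 ≤ n := by rw [hn]; positivity
    refine lt_of_le_of_ne h0 fun h => hw0 ((eq_zero_iff w).2 ⟨?_, ?_, ?_, hw3⟩) <;>
      nlinarith [sq_nonneg (w 0), sq_nonneg (w 1), sq_nonneg (w 2)]
  have hD : 0 < m ^ 2 - n * Q v := by nlinarith [sq_nonneg m]
  have hr := Real.sqrt_pos.2 hD
  have hr2 := Real.sq_sqrt hD.le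
  set r := √(m ^ 2 - n * Q v)
  have hcomb : ∀ α β : ℝ, Q (α • v + β • w) = α ^ 2 * Q v + 2 * m * (α * β) + n * β ^ 2 := by
    intro α β
    simp only [Q, PiLp.add_apply, PiLp.smul_apply, smul_eq_mul, hw3, hm, hn]
    ring
  have hne : ∀ β : ℝ, v + β • w ≠ 0 := by
    intro β h
    have : v 3 + β * w 3 = 0 := by simpa using congrArg (fun u : V => u 3) h
    rw [hw3, mul_zero, add_zero] at this
    exact hv3 this
  have hinc : ∀ β : ℝ, Incident (pt (v + β • w) (hne β)) L := fun β =>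
    (incident_pt _).2 (L.1.add_mem hv (L.1.smul_mem β hw))
  have hmem : ∀ β : ℝ, n * Q (v + β • w) = (n * β + m - r) * (n * β + m + r) := by
    intro β
    have := hcomb 1 β
    rw [one_smul] at this
    rw [this]
    linear_combination hr2
  have hsph : ∀ β : ℝ, (n * β + m - r) * (n * β + m + r) = 0 →
      pt (v + β • w) (hne β) ∈ sphere := by
    intro β h
    rw [pt_mem_sphere]
    rw [← hmem] at h
    exact (mul_eq_zero.1 h).resolve_left hnpos.ne'
  refine Set.ncard_eq_two.2 ⟨pt _ (hne ((-m + r) / n)), pt _ (hne ((-m - r) / n)), ?_, ?_⟩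
  · intro h
    obtain ⟨c, hc⟩ := (pt_eq_pt_iff _ _).1 h
    have h3 : v 3 + (-m + r) / n * w 3 = c * (v 3 + (-m - r) / n * w 3) := by
      simpa only [PiLp.add_apply, PiLp.smul_apply, smul_eq_mul] using
        congrArg (fun u : V => u 3) hc
    rw [hw3, mul_zero, mul_zero, add_zero] at h3
    have hc1 : c = 1 := mul_right_cancel₀ hv3 (by linarith)
    rw [hc1, one_smul, add_right_inj, ← sub_eq_zero, ← sub_smul, smul_eq_zero] at hc
    have := hc.resolve_right hw0
    field_simp at this
    linarith
  · ext p
    simp only [mem_ofPred_eq, mem_insert_iff, mem_singleton_iff]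
    constructor
    · rintro ⟨hps, hpL⟩
      obtain ⟨u, hu, rfl⟩ := exists_eq_pt p
      rw [pt_mem_sphere] at hps
      obtain ⟨α, β, rfl⟩ := exists_eq_comb hi hv hw ((incident_pt hu).1 hpL)
      have hα : α ≠ 0 := by
        rintro rfl
        rw [hcomb] at hps
        have : β = 0 := by
          have : n * β ^ 2 = 0 := by linarith
          exact pow_eq_zero_iff two_ne_zero |>.1 ((mul_eq_zero.1 this).resolve_left hnpos.ne')
        exact hu (by simp [this])
      have hprod : (n * (β / α) + m - r) * (n * (β / α) + m + r) = 0 := by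
        rw [← hmem]
        have e := hcomb 1 (β / α)
        rw [one_smul] at e
        rw [hcomb] at hps
        rw [e]
        field_simp
        linear_combination n * hps
      have huv : α • v + β • w = α • (v + (β / α) • w) := by
        rw [smul_add, smul_smul]; congr 2; field_simp
      rcases mul_eq_zero.1 hprod with h | h
      · left
        rw [pt_eq_pt_iff]
        refine ⟨α, ?_⟩
        rw [huv]; congr 3; rw [eq_div_iff hnpos.ne']; linarith
      · right
        rw [pt_eq_pt_iff]
        refine ⟨α, ?_⟩
        rw [huv]; congr 3; rw [eq_div_iff hnpos.ne']; linarith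
    · rintro (rfl | rfl)
      · refine ⟨hsph _ ?_, hinc _⟩
        field_simp; ring
      · refine ⟨hsph _ ?_, hinc _⟩
        field_simp; ring

/-- Through a point that is not inside the sphere there is a line that is no 2-secant. -/
theorem not_isInterior_of_nonneg {v : V} (hv : v ≠ 0) (hQ : 0 ≤ Q v) :
    ¬ IsInterior (pt v hv) := by
  -- A direction `u` orthogonal to `v` makes `Q` diagonal on the line: `α² Q v + β² |u|²` vanishes
  -- only for `β = 0`, so `v` is the only possible sphere point.
  obtain ⟨u, hu0, hu3, hperp⟩ : ∃ u : V, u ≠ 0 ∧ u 3 = 0 ∧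
      v 0 * u 0 + v 1 * u 1 + v 2 * u 2 = 0 := by
    by_cases h : v 0 = 0 ∧ v 1 = 0
    · refine ⟨!₂[1, 0, 0, 0], fun h => ?_, by simp, by simp [h]⟩
      simpa using congrArg (fun u : V => u 0) h
    · refine ⟨!₂[-v 1, v 0, 0, 0], fun h' => h ⟨?_, ?_⟩, by simp, by simp; ring⟩
      · simpa using congrArg (fun u : V => u 1) h'
      · simpa using congrArg (fun u : V => u 0) h'
  have hn : 0 < u 0 ^ 2 + u 1 ^ 2 + u 2 ^ 2 := by
    refine lt_of_le_of_ne (by positivity) fun h => hu0 ((eq_zero_iff u).2 ⟨?_, ?_, ?_, hu3⟩) <;>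
      nlinarith [sq_nonneg (u 0), sq_nonneg (u 1), sq_nonneg (u 2)]
  have hcomb : ∀ α β : ℝ, Q (α • v + β • u) =
      α ^ 2 * Q v + β ^ 2 * (u 0 ^ 2 + u 1 ^ 2 + u 2 ^ 2) := by
    intro α β
    simp only [Q, PiLp.add_apply, PiLp.smul_apply, smul_eq_mul, hu3]
    linear_combination 2 * α * β * hperp
  have hi : LinearIndependent ℝ ![v, u] := by
    rw [LinearIndependent.pair_iff]
    intro α β h
    have hβ : β = 0 := by
      have h1 := hcomb α β
      rw [h] at h1
      have h0 : Q (0 : V) = 0 := by simp [Q]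
      rw [h0] at h1
      have h2 : 0 ≤ α ^ 2 * Q v := by positivity
      by_contra hβ
      have : 0 < β ^ 2 * (u 0 ^ 2 + u 1 ^ 2 + u 2 ^ 2) := by positivity
      linarith
    refine ⟨?_, hβ⟩
    rw [hβ, zero_smul, add_zero] at h
    exact (smul_eq_zero.1 h).resolve_right hv
  have hf : finrank ℝ (Submodule.span ℝ (Set.range ![v, u])) = 2 := by
    simpa using finrank_span_eq_card hi
  intro hint
  have hvm : v ∈ Submodule.span ℝ (Set.range ![v, u]) := Submodule.subset_span ⟨0, rfl⟩
  have hum : u ∈ Submodule.span ℝ (Set.range ![v, u]) := Submodule.subset_span ⟨1, rfl⟩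
  have h2 := hint ⟨_, hf⟩ ((incident_pt hv).2 hvm)
  obtain ⟨p, q, hpq, hset⟩ := Set.ncard_eq_two.1 h2
  have key : ∀ p : Point, p ∈ sphere → Incident p ⟨_, hf⟩ → p = pt v hv := by
    intro p hp hpL
    obtain ⟨x, hx, rfl⟩ := exists_eq_pt p
    rw [pt_mem_sphere] at hp
    obtain ⟨α, β, rfl⟩ := exists_eq_comb (L := ⟨_, hf⟩) hi hvm hum ((incident_pt hx).1 hpL)
    have hβ : β = 0 := by
      rw [hcomb] at hp
      have h2 : 0 ≤ α ^ 2 * Q v := by positivity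
      by_contra hβ
      have : 0 < β ^ 2 * (u 0 ^ 2 + u 1 ^ 2 + u 2 ^ 2) := by positivity
      linarith
    rw [pt_eq_pt_iff]
    exact ⟨α, by simp [hβ]⟩
  have hp : p ∈ ({p, q} : Set Point) := by simp
  have hq : q ∈ ({p, q} : Set Point) := by simp
  rw [← hset] at hp hq
  exact hpq ((key p hp.1 hp.2).trans (key q hq.1 hq.2).symm)

theorem not_isInterior_pt {v : V} (hv : v ≠ 0) : ¬ IsInterior (pt v hv) ↔ 0 ≤ Q v := by
  refine ⟨fun h => ?_, not_isInterior_of_nonneg hv⟩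
  by_contra hQ
  exact h fun L hL => isTwoSecant_of_neg ((incident_pt hv).1 hL) (not_le.1 hQ)

theorem isGLStar_iff {S : Set Line} : IsGLStar S ↔ (∀ L ∈ S, IsTwoSecant L) ∧
    ∀ v : V, v ≠ 0 → 0 ≤ Q v → ∃! L : Line, L ∈ S ∧ v ∈ L.1 := by
  constructor
  · intro h
    refine ⟨h.1, fun v hv hQ => ?_⟩
    simpa only [incident_pt] using h.2 (pt v hv) (not_isInterior_of_nonneg hv hQ)
  · rintro ⟨h1, h2⟩
    refine ⟨h1, fun p hp => ?_⟩
    obtain ⟨v, hv, rfl⟩ := exists_eq_pt p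
    simpa only [incident_pt] using h2 v hv ((not_isInterior_pt hv).1 hp)

/-! ### Topology of the Grassmannian and continuity criteria. -/

/-- The orthogonal projection onto a subspace, as a map on the Grassmann manifold. -/
def proj {k : ℕ} (U : Grass k) : V →L[ℝ] V := U.1.starProjection

theorem isEmbedding_proj (k : ℕ) : IsEmbedding (proj (k := k)) :=
  ⟨⟨rfl⟩, fun _ _ h => Subtype.ext (Submodule.starProjection_inj.1 h)⟩

instance (k : ℕ) : T2Space (Grass k) := (isEmbedding_proj k).t2Space

theorem incident_iff_proj {p : Point} {L : Line} : Incident p L ↔ proj L ∘L proj p = proj p := by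
  constructor
  · intro h
    ext1 v
    exact Submodule.starProjection_eq_self_iff.2 (h (Submodule.starProjection_apply_mem _ v))
  · intro h v hv
    have := congrArg (fun T : V →L[ℝ] V => T v) h
    have hp : proj p v = v := Submodule.starProjection_eq_self_iff.2 hv
    simp only [ContinuousLinearMap.comp_apply, hp] at this
    exact Submodule.starProjection_eq_self_iff.1 this

theorem isClosed_incident : IsClosed {x : Point × Line | Incident x.1 x.2} := by
  simp only [incident_iff_proj]
  have h1 := (isEmbedding_proj 1).continuous
  have h2 := (isEmbedding_proj 2).continuous
  exact isClosed_eq (((h2.comp continuous_snd)).clm_comp (h1.comp continuous_fst))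
    (h1.comp continuous_fst)

/-- A map assigning to every non-interior point the unique line of a compact set of lines
through it is continuous. -/
theorem isTopological_of_isCompact {S : Set Line} (hS : IsCompact S)
    (h : ∀ p : Point, ¬ IsInterior p → ∃! L : Line, L ∈ S ∧ Incident p L) : IsTopological S := by
  choose f hf hu using fun p : {p : Point // ¬ IsInterior p} => h p.1 p.2
  refine ⟨f, ?_, hf⟩
  rw [continuous_iff_isClosed]
  intro C hC
  have : CompactSpace S := isCompact_iff_compactSpace.1 hS
  -- Closed graph argument: the preimage of `C` is the projection of this closed set along the
  -- compact factor `S`.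
  have hcl : IsClosed {x : {p : Point // ¬ IsInterior p} × S |
      Incident x.1.1 x.2.1 ∧ x.2.1 ∈ C} := by
    apply IsClosed.inter
    · exact isClosed_incident.preimage
        ((continuous_subtype_val.comp continuous_fst).prodMk
          (continuous_subtype_val.comp continuous_snd))
    · exact hC.preimage (continuous_subtype_val.comp continuous_snd)
  have := isClosedMap_fst_of_compactSpace _ hcl
  convert this using 1
  ext p
  constructor
  · intro hp
    exact ⟨(p, ⟨f p, (hf p).1⟩), ⟨(hf p).2, hp⟩, rfl⟩
  · rintro ⟨⟨q, L⟩, ⟨hi, hL⟩, rfl⟩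
    rw [mem_preimage, ← hu q L.1 ⟨L.2, hi⟩]
    exact hL

/-- A linear form vanishing on the limit of a family of subspaces tends to zero along every bounded
selection of vectors in these subspaces. -/
theorem tendsto_form_of_tendsto {k : ℕ} {X : Type*} {l : Filter X} {L : X → Grass k} {L₀ : Grass k}
    (hL : Tendsto L l (𝓝 L₀)) {p : X → V} {B : ℝ} (hB : ∀ x, ‖p x‖ ≤ B)
    (hp : ∀ x, p x ∈ (L x).1) (φ : V →L[ℝ] ℝ) (hφ : ∀ v ∈ L₀.1, φ v = 0) :
    Tendsto (fun x => φ (p x)) l (𝓝 0) := by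
  have h1 : Tendsto (fun x => proj (L x) - proj L₀) l (𝓝 0) := by
    have := (((isEmbedding_proj k).continuous.tendsto L₀).comp hL).sub_const (proj L₀)
    simpa using this
  have h2 : Tendsto (fun x => ‖φ‖ * (‖proj (L x) - proj L₀‖ * B)) l (𝓝 0) := by
    have := ((h1.norm.mul_const B).const_mul ‖φ‖)
    simpa using this
  refine squeeze_zero_norm (fun x => ?_) h2
  have e : φ (p x) = φ ((proj (L x) - proj L₀) (p x)) := by
    have e1 : proj (L x) (p x) = p x := Submodule.starProjection_eq_self_iff.2 (hp x)
    have e2 : φ (proj L₀ (p x)) = 0 := hφ _ (Submodule.starProjection_apply_mem _ _)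
    rw [sub_apply, map_sub, e1, e2, sub_zero]
  rw [e]
  calc ‖φ ((proj (L x) - proj L₀) (p x))‖ ≤ ‖φ‖ * ‖(proj (L x) - proj L₀) (p x)‖ := φ.le_opNorm _
    _ ≤ ‖φ‖ * (‖proj (L x) - proj L₀‖ * ‖p x‖) := by
        gcongr; exact ContinuousLinearMap.le_opNorm _ _
    _ ≤ _ := by gcongr; exact hB x

/-- The orthogonal projection onto the line spanned by a vector. -/
def projVec (v : V) : V →L[ℝ] V := (‖v‖ ^ 2)⁻¹ • (innerSL ℝ v).smulRight v

theorem continuousOn_projVec : ContinuousOn projVec {v | v ≠ 0} := by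
  unfold projVec
  apply ContinuousOn.fun_smul
  · exact ContinuousOn.inv₀ (by fun_prop) (fun v hv => by simpa using hv)
  · apply Continuous.continuousOn
    have : Continuous fun v : V => (ContinuousLinearMap.smulRightL ℝ V V (innerSL ℝ v)) v :=
      ((ContinuousLinearMap.smulRightL ℝ V V).continuous.comp
        (innerSL ℝ).continuous).clm_apply continuous_id
    exact this

theorem projVec_apply (v w : V) : projVec v w = (inner ℝ v w / ‖v‖ ^ 2) • v := by
  simp [projVec, smul_smul, div_eq_inv_mul]

theorem proj_pt {v : V} (hv : v ≠ 0) : proj (pt v hv) = projVec v := by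
  ext1 w
  rw [projVec_apply]
  exact Submodule.starProjection_singleton ℝ w

theorem continuous_pt {X : Type*} [TopologicalSpace X] {u : X → V} (hu : Continuous u)
    (h0 : ∀ x, u x ≠ 0) : Continuous fun x => pt (u x) (h0 x) := by
  rw [(isEmbedding_proj 1).continuous_iff]
  simp only [Function.comp_def, proj_pt]
  exact continuousOn_projVec.comp_continuous hu h0

/-- The orthogonal projection onto a line with an orthogonal basis. -/
theorem proj_line {L : Line} {u v : V} (hu0 : u ≠ 0) (hv0 : v ≠ 0) (huv : inner ℝ u v = 0)
    (hu : u ∈ L.1) (hv : v ∈ L.1) : proj L = projVec u + projVec v := by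
  have hi : LinearIndependent ℝ ![u, v] := by
    rw [LinearIndependent.pair_iff]
    intro α β h
    have h1 : inner ℝ u (α • u + β • v) = 0 := by rw [h, inner_zero_right]
    have h2 : inner ℝ v (α • u + β • v) = 0 := by rw [h, inner_zero_right]
    rw [inner_add_right, inner_smul_right, inner_smul_right, huv, mul_zero, add_zero] at h1
    rw [inner_add_right, inner_smul_right, inner_smul_right, real_inner_comm, huv, mul_zero,
      zero_add] at h2
    exact ⟨(mul_eq_zero.1 h1).resolve_right (by simpa using hu0),
      (mul_eq_zero.1 h2).resolve_right (by simpa using hv0)⟩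
  have hf : finrank ℝ (Submodule.span ℝ (Set.range ![u, v])) = 2 := by
    simpa using finrank_span_eq_card hi
  have hL : (⟨_, hf⟩ : Line) = L :=
    line_eq_of_mem hi (Submodule.subset_span ⟨0, rfl⟩) (Submodule.subset_span ⟨1, rfl⟩) hu hv
  ext1 w
  apply Submodule.eq_starProjection_of_mem_of_inner_eq_zero
  · rw [add_apply, projVec_apply, projVec_apply]
    exact L.1.add_mem (L.1.smul_mem _ hu) (L.1.smul_mem _ hv)
  · intro x hx
    rw [← hL] at hx
    change x ∈ Submodule.span ℝ (Set.range ![u, v]) at hx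
    rw [Matrix.range_cons_cons_empty, Submodule.mem_span_pair] at hx
    obtain ⟨α, β, rfl⟩ := hx
    have hu2 : ‖u‖ ^ 2 ≠ 0 := by simpa using hu0
    have hv2 : ‖v‖ ^ 2 ≠ 0 := by simpa using hv0
    have hvu : inner ℝ v u = 0 := by rw [real_inner_comm, huv]
    simp only [add_apply, projVec_apply, inner_sub_left, inner_add_left,
      inner_add_right, real_inner_smul_left, real_inner_smul_right, huv, hvu,
      real_inner_self_eq_norm_sq]
    rw [real_inner_comm w u, real_inner_comm w v]
    field_simp
    ring

/-- A Gram-Schmidt step, scaled by `‖u‖²` to avoid division, gives a continuous orthogonal basis;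
the projection is then a sum of two continuous rank-one projections. -/
theorem continuousOn_line {X : Type*} [TopologicalSpace X] {s : Set X} {L : X → Line} {u v : X → V}
    (hu : ContinuousOn u s) (hv : ContinuousOn v s)
    (hi : ∀ x ∈ s, LinearIndependent ℝ ![u x, v x])
    (huL : ∀ x ∈ s, u x ∈ (L x).1) (hvL : ∀ x ∈ s, v x ∈ (L x).1) : ContinuousOn L s := by
  rw [(isEmbedding_proj 2).continuousOn_iff]
  set w : X → V := fun x => (‖u x‖ ^ 2) • v x - (inner ℝ (u x) (v x)) • u x with hw
  have hu0 : ∀ x ∈ s, u x ≠ 0 := fun x hx => (hi x hx).ne_zero 0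
  have hw0 : ∀ x ∈ s, w x ≠ 0 := by
    intro x hx h
    have := LinearIndependent.pair_iff.1 (hi x hx) (-(inner ℝ (u x) (v x))) (‖u x‖ ^ 2) (by
      rw [← h, hw]; module)
    simp [hu0 x hx] at this
  have hwc : ContinuousOn w s := by fun_prop
  have key : ∀ x ∈ s, (proj ∘ L) x = projVec (u x) + projVec (w x) := by
    intro x hx
    apply proj_line (hu0 x hx) (hw0 x hx) _ (huL x hx)
    · exact (L x).1.sub_mem ((L x).1.smul_mem _ (hvL x hx)) ((L x).1.smul_mem _ (huL x hx))
    · simp only [hw, inner_sub_right, real_inner_smul_right, real_inner_self_eq_norm_sq]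
      ring
  exact ((continuousOn_projVec.comp hu hu0).add (continuousOn_projVec.comp hwc hw0)).congr key

/-! ### Rotational families and their description by reguli. -/

/-- The set of lines consisting of the axis `Z` and all rotated copies of the lines
`gen a (b a) (g a)`. -/
def rotStar (b g : ℝ≥0 → ℝ) : Set Line :=
  {L | L = zAxis ∨ ∃ (θ : ℝ) (a : ℝ≥0), L = rotLine θ (gen a (b a) (g a))}

theorem isRotational_rotStar (b g : ℝ≥0 → ℝ) : IsRotational (rotStar b g) := by
  rintro θ L (rfl | ⟨η, a, rfl⟩)
  · exact Or.inl (rotLine_zAxis θ)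
  · exact Or.inr ⟨θ + η, a, rotLine_rotLine _ _ _⟩

/-- The quarter turn appears because `gen 0 0 0` is the `y`-axis. -/
theorem rotLine_xAxis (θ : ℝ) : rotLine θ xAxis = rotLine (θ - Real.pi / 2) (gen 0 0 0) := by
  apply line_eq_of_le
  intro v hv
  rw [mem_rotLine, mem_xAxis] at hv
  rw [mem_rotLine_gen, Real.cos_sub_pi_div_two, Real.sin_sub_pi_div_two]
  have h1 : -Real.sin θ * v 0 + Real.cos θ * v 1 = 0 := by simpa using hv.1
  have h2 : v 2 = 0 := by simpa using hv.2
  exact ⟨by linear_combination -h1, by rw [h2]; ring⟩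

theorem rotLine_gen_zero (θ : ℝ) : rotLine θ (gen 0 0 0) = rotLine (θ + Real.pi / 2) xAxis := by
  rw [rotLine_xAxis, add_sub_cancel_right]

theorem inSurface_rotLine_gen {θ a b g c : ℝ} (hc : c ^ 2 = a ^ 2 * g ^ 2) :
    InSurface a b c (rotLine θ (gen a b g)) := by
  intro v hv
  have := onSurface_of_mem hv
  unfold OnSurface at this
  rw [this, hc]; ring

/-- Three points suffice: the point at infinity gives the slope, and the point nearest to `Z`
together with one further point gives `b` and `c²`. -/
theorem eq_of_inSurface {θ a b c a' b' g : ℝ} (ha : 0 < a) (ha' : 0 < a')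
    (h : InSurface a b c (rotLine θ (gen a' b' g))) : a' = a ∧ b' = b ∧ c ^ 2 = a ^ 2 * g ^ 2 := by
  have hs := Real.sin_sq_add_cos_sq θ
  have h0 := h _ (direction_mem_rotLine_gen θ a' b' g)
  have h1 := h !₂[g * Real.cos θ, g * Real.sin θ, b', 1] (by
    rw [mem_rotLine_gen]
    constructor
    · simp; linear_combination g * hs
    · change b' = b' * 1 + a' * (-Real.sin θ * (g * Real.cos θ) + Real.cos θ * (g * Real.sin θ))
      ring)
  have h2 := h !₂[g * Real.cos θ - Real.sin θ, g * Real.sin θ + Real.cos θ, b' + a', 1] (by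
    rw [mem_rotLine_gen]
    constructor
    · simp; linear_combination g * hs
    · simp; linear_combination -a' * hs)
  simp at h0 h1 h2
  have e1 : a' = a := by
    have : a' ^ 2 = a ^ 2 := by linear_combination -h0
    exact (pow_left_inj₀ ha'.le ha.le two_ne_zero).1 this
  subst e1
  have e2 : b' = b := by
    have : 2 * a' * (b' - b) = 0 := by linear_combination h1 - h2 + a' ^ 2 * hs
    have := (mul_eq_zero.1 this).resolve_left (by positivity)
    linarith
  subst e2
  exact ⟨rfl, rfl, by linear_combination -h1 + a' ^ 2 * g ^ 2 * hs⟩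

/-- The moment `q 0 * d 1 - q 1 * d 0` does not depend on the point `q` of the line; it equals `g
μ`, where `μ > 0` rescales an upward direction. -/
theorem hasOrientation_rotLine_gen {θ a b g : ℝ} (ha : 0 < a) (ε : ℤˣ) :
    HasOrientation ε (rotLine θ (gen a b g)) ↔ 0 < ((ε : ℤ) : ℝ) * g := by
  have hs := Real.sin_sq_add_cos_sq θ
  constructor
  · rintro ⟨q, d, hd, hL, hd2, ho⟩
    have hq : (!₂[q 0, q 1, q 2, 1] : V) ∈ (rotLine θ (gen a b g)).1 := by
      rw [hL, mem_affineLine]; exact ⟨0, by simp⟩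
    have hdm : (!₂[d 0, d 1, d 2, 0] : V) ∈ (rotLine θ (gen a b g)).1 := by
      rw [hL, mem_affineLine]; exact ⟨1, by simp⟩
    rw [mem_rotLine_gen] at hq hdm
    obtain ⟨hq1, -⟩ := hq
    obtain ⟨hd1, hd2'⟩ := hdm
    simp at hq1 hd1 hd2'
    set μ := -(Real.sin θ * d 0) + Real.cos θ * d 1 with hμ
    have hμ0 : 0 < μ := by
      rw [hd2'] at hd2
      exact pos_of_mul_pos_right hd2 ha.le
    have e0 : d 0 = -Real.sin θ * μ := by
      linear_combination Real.cos θ * hd1 + Real.sin θ * hμ - d 0 * hs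
    have e1 : d 1 = Real.cos θ * μ := by
      linear_combination Real.sin θ * hd1 - Real.cos θ * hμ - d 1 * hs
    have : ((ε : ℤ) : ℝ) * (q 0 * d 1 - q 1 * d 0) = (((ε : ℤ) : ℝ) * g) * μ := by
      rw [e0, e1, ← hq1]; ring
    rw [this] at ho
    exact pos_of_mul_pos_left ho hμ0.le
  · intro hg
    have hd : (![-Real.sin θ, Real.cos θ, a] : Fin 3 → ℝ) ≠ 0 := fun h =>
      ha.ne' (by simpa using congrFun h 2)
    refine ⟨![g * Real.cos θ, g * Real.sin θ, b], ![-Real.sin θ, Real.cos θ, a], hd, ?_, ?_, ?_⟩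
    · symm
      apply line_eq_of_le
      intro v hv
      obtain ⟨τ, h0, h1, h2⟩ := mem_affineLine.1 hv
      simp at h0 h1 h2
      rw [mem_rotLine_gen, h0, h1, h2]
      constructor
      · linear_combination v 3 * g * hs
      · linear_combination -a * τ * hs
    · simpa using ha
    · change 0 < ((ε : ℤ) : ℝ) * (g * Real.cos θ * Real.cos θ - g * Real.sin θ * -Real.sin θ)
      convert hg using 2
      linear_combination g * hs

/-- A line on the surface is some rotated `gen a b g'` with `g'² = g²`; the orientation decides the
sign of `g'`. -/
theorem star_eq_rotStar {b c g : ℝ≥0 → ℝ} {ε : ℝ≥0 → ℤˣ} (hb : b 0 = 0) (hg : g 0 = 0)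
    (hc : ∀ a, c a = a * |g a|) (hε : ∀ a, 0 < a → g a ≠ 0 → 0 < ((ε a : ℤ) : ℝ) * g a) :
    star b c ε = rotStar b g := by
  have hc2 : ∀ a : ℝ≥0, c a ^ 2 = (a : ℝ) ^ 2 * g a ^ 2 := fun a => by
    rw [hc, mul_pow, sq_abs]
  ext L
  constructor
  · rintro (rfl | ⟨θ, rfl⟩ | ⟨a, ha, hL, ho⟩)
    · exact Or.inl rfl
    · refine Or.inr ⟨θ - Real.pi / 2, 0, ?_⟩
      rw [rotLine_xAxis, hb, hg]; rfl
    · have ha' : (0 : ℝ) < a := ha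
      -- The surface equation at the point at infinity `d` and at the trace `w` in `z = 0` shows
      -- that `L` is neither horizontal nor vertical nor at infinity.
      obtain ⟨d, hd, hd0, hd3⟩ := exists_mem_coord_eq_zero L 3
      obtain ⟨w, hw, hw0, hw2⟩ := exists_mem_coord_eq_zero L 2
      have ed := hL d hd
      have ew := hL w hw
      rw [hd3] at ed
      rw [hw2] at ew
      have hd2 : d 2 ≠ 0 := by
        intro h
        rw [h] at ed
        have : d 0 ^ 2 + d 1 ^ 2 = 0 := by
          have : (a : ℝ) ^ 2 * (d 0 ^ 2 + d 1 ^ 2) = 0 := by linarith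
          exact (mul_eq_zero.1 this).resolve_left (by positivity)
        exact hd0 ((eq_zero_iff d).2 ⟨by nlinarith [sq_nonneg (d 0), sq_nonneg (d 1)],
          by nlinarith [sq_nonneg (d 0), sq_nonneg (d 1)], h, hd3⟩)
      have hd01 : d 0 ≠ 0 ∨ d 1 ≠ 0 := by
        by_contra! h
        rw [h.1, h.2] at ed
        exact hd2 (pow_eq_zero_iff two_ne_zero |>.1 (by linarith))
      have hw3 : w 3 ≠ 0 := by
        intro h
        rw [h] at ew
        have : w 0 ^ 2 + w 1 ^ 2 = 0 := by
          have : (a : ℝ) ^ 2 * (w 0 ^ 2 + w 1 ^ 2) = 0 := by linarith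
          exact (mul_eq_zero.1 this).resolve_left (by positivity)
        exact hw0 ((eq_zero_iff w).2 ⟨by nlinarith [sq_nonneg (w 0), sq_nonneg (w 1)],
          by nlinarith [sq_nonneg (w 0), sq_nonneg (w 1)], hw2, h⟩)
      obtain ⟨θ, a', b', g', ha0, rfl⟩ := exists_eq_rotLine_gen hd hd3 hd2 hd01 hw hw3
      obtain ⟨rfl, rfl, hg2⟩ := eq_of_inSurface ha' ha0 hL
      refine Or.inr ⟨θ, a, ?_⟩
      rw [hc2] at hg2
      have hsq : g a ^ 2 = g' ^ 2 := mul_left_cancel₀ (by positivity) hg2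
      suffices h : g' = g a by rw [h]
      by_cases h0 : g a = 0
      · rw [h0] at hsq ⊢
        exact pow_eq_zero_iff two_ne_zero |>.1 (by linarith)
      · have ho' := (hasOrientation_rotLine_gen ha0 _).1 (ho.resolve_left (by
          rw [hc]; positivity))
        rcases sq_eq_sq_iff_eq_or_eq_neg.1 hsq with h | h
        · exact h.symm
        · have := hε a ha h0
          rw [h] at this
          linarith
  · rintro (rfl | ⟨θ, a, rfl⟩)
    · exact Or.inl rfl
    · rcases eq_zero_or_pos a with rfl | ha
      · refine Or.inr (Or.inl ⟨θ + Real.pi / 2, ?_⟩)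
        rw [← rotLine_gen_zero, hb, hg]; rfl
      · refine Or.inr (Or.inr ⟨a, ha, inSurface_rotLine_gen (hc2 a), ?_⟩)
        by_cases h0 : g a = 0
        · left; rw [hc, h0]; simp
        · right
          exact (hasOrientation_rotLine_gen ha _).2 (hε a ha h0)

/-- The quantity `g² + (b/a)²` is the squared distance from the origin to the trace of the line in
`z = 0`. For `a = 0` the convention `b / 0 = 0` selects the origin itself. -/
theorem isTwoSecant_rotLine_gen {θ a b g : ℝ} (ha : a ≠ 0 ∨ b = 0 ∧ g = 0)
    (h : g ^ 2 + (b / a) ^ 2 < 1) : IsTwoSecant (rotLine θ (gen a b g)) := by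
  have hs := Real.sin_sq_add_cos_sq θ
  apply isTwoSecant_of_neg (v := !₂[Real.cos θ * g + Real.sin θ * (b / a),
    Real.sin θ * g - Real.cos θ * (b / a), 0, 1])
  · rw [mem_rotLine_gen]
    constructor
    · simp; linear_combination g * hs
    · have : a * (b / a) = b := by
        rcases ha with ha | ⟨rfl, -⟩
        · field_simp
        · simp
      simp
      linear_combination a * (b / a) * hs + this
  · simp [Q]
    have : (Real.cos θ * g + Real.sin θ * (b / a)) ^ 2 +
        (Real.sin θ * g - Real.cos θ * (b / a)) ^ 2 = g ^ 2 + (b / a) ^ 2 := by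
      linear_combination (g ^ 2 + (b / a) ^ 2) * hs
    rw [this]; exact h

theorem coe_ne_zero_or {b g : ℝ≥0 → ℝ} (hb : b 0 = 0) (hg : g 0 = 0) (a : ℝ≥0) :
    (a : ℝ) ≠ 0 ∨ b a = 0 ∧ g a = 0 := by
  rcases eq_or_ne a 0 with rfl | h
  · exact Or.inr ⟨hb, hg⟩
  · exact Or.inl (by exact_mod_cast h)

/-- A criterion for `rotStar b g` to be a gl star. -/
theorem isGLStar_rotStar {b g : ℝ≥0 → ℝ} (hb : b 0 = 0) (hg : g 0 = 0)
    (hin : ∀ a : ℝ≥0, g a ^ 2 + (b a / a) ^ 2 < 1)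
    (hu : ∀ v : V, v 0 ≠ 0 ∨ v 1 ≠ 0 → 0 ≤ Q v → ∃! a : ℝ≥0, OnSurface a (b a) (g a) v)
    (hax : ∀ v : V, v 0 = 0 → v 1 = 0 → v 2 ≠ 0 → 0 ≤ Q v →
      ∀ a : ℝ≥0, ¬ OnSurface a (b a) (g a) v) :
    IsGLStar (rotStar b g) := by
  rw [isGLStar_iff]
  constructor
  · rintro L (rfl | ⟨θ, a, rfl⟩)
    · exact isTwoSecant_of_neg (v := !₂[0, 0, 0, 1]) (by simp [mem_zAxis]) (by simp [Q])
    · exact isTwoSecant_rotLine_gen (coe_ne_zero_or hb hg a) (hin a)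
  · intro v hv hQ
    by_cases h01 : v 0 = 0 ∧ v 1 = 0
    · have h2 : v 2 ≠ 0 := by
        intro h2
        have h3 : v 3 ≠ 0 := fun h3 => hv ((eq_zero_iff v).2 ⟨h01.1, h01.2, h2, h3⟩)
        have : 0 < v 3 ^ 2 := by positivity
        simp only [Q, h01.1, h01.2, h2] at hQ
        linarith
      refine ⟨zAxis, ⟨Or.inl rfl, mem_zAxis.2 h01⟩, ?_⟩
      rintro L ⟨rfl | ⟨θ, a, rfl⟩, hL⟩
      · rfl
      · exact absurd (onSurface_of_mem hL) (hax v h01.1 h01.2 h2 hQ a)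
    · have h01' : v 0 ≠ 0 ∨ v 1 ≠ 0 := by tauto
      obtain ⟨a, ha, hau⟩ := hu v h01' hQ
      obtain ⟨θ, hθ⟩ := exists_mem_rotLine_gen (coe_ne_zero_or hb hg a) ha
      refine ⟨_, ⟨Or.inr ⟨θ, a, rfl⟩, hθ⟩, ?_⟩
      rintro L ⟨rfl | ⟨η, a', rfl⟩, hL⟩
      · exact absurd (mem_zAxis.1 hL) h01
      · obtain rfl := hau a' (onSurface_of_mem hL)
        exact rotLine_gen_eq_of_mem (coe_ne_zero_or hb hg _) h01' hL hθ

/-! ### Compactness of rotational families. -/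

theorem continuous_vec {X : Type*} [TopologicalSpace X] {x y z w : X → ℝ} (hx : Continuous x)
    (hy : Continuous y) (hz : Continuous z) (hw : Continuous w) :
    Continuous fun p => (!₂[x p, y p, z p, w p] : V) := by
  refine (PiLp.continuous_toLp 2 _).comp (continuous_pi fun i => ?_)
  fin_cases i <;> simpa

theorem tendsto_vec {X : Type*} {l : Filter X} {x y z w : X → ℝ} {x₀ y₀ z₀ w₀ : ℝ}
    (hx : Tendsto x l (𝓝 x₀)) (hy : Tendsto y l (𝓝 y₀)) (hz : Tendsto z l (𝓝 z₀))
    (hw : Tendsto w l (𝓝 w₀)) :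
    Tendsto (fun p => (!₂[x p, y p, z p, w p] : V)) l (𝓝 !₂[x₀, y₀, z₀, w₀]) := by
  refine ((PiLp.continuous_toLp 2 _).tendsto _).comp (tendsto_pi_nhds.2 fun i => ?_)
  fin_cases i <;> simpa

theorem rotLine_periodic (L : Line) : Function.Periodic (fun θ => rotLine θ L) (2 * Real.pi) := by
  intro θ
  apply line_eq_of_le
  intro v hv
  rw [mem_rotLine] at hv ⊢
  simpa using hv

/-- The line spanned by two linearly independent vectors. -/
def lineOf (u v : V) (h : LinearIndependent ℝ ![u, v]) : Line :=
  ⟨Submodule.span ℝ (Set.range ![u, v]), by simpa using finrank_span_eq_card h⟩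

/-- The line spanned by a pair of vectors (a default line for dependent pairs). -/
def spanLine (p : V × V) : Line :=
  open Classical in
  if h : LinearIndependent ℝ ![p.1, p.2] then lineOf p.1 p.2 h else zAxis

theorem mem_spanLine {p : V × V} (h : LinearIndependent ℝ ![p.1, p.2]) :
    p.1 ∈ (spanLine p).1 ∧ p.2 ∈ (spanLine p).1 := by
  rw [spanLine, dif_pos h]
  exact ⟨Submodule.subset_span ⟨0, rfl⟩, Submodule.subset_span ⟨1, rfl⟩⟩

theorem continuous_rot : Continuous fun x : V × ℝ => rot x.2 x.1 := by
  have h : ∀ i : Fin 4, Continuous fun x : V × ℝ => x.1 i := fun i =>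
    (coord i).continuous.comp continuous_fst
  have h0 := h 0
  have h1 := h 1
  have h2 := h 2
  have h3 := h 3
  exact continuous_vec (by fun_prop) (by fun_prop) h2 h3

theorem continuousOn_rotLine_spanLine :
    ContinuousOn (fun x : (V × V) × ℝ => rotLine x.2 (spanLine x.1))
      {x | LinearIndependent ℝ ![x.1.1, x.1.2]} := by
  have h1 : Continuous fun x : (V × V) × ℝ => rot x.2 x.1.1 :=
    continuous_rot.comp (f := fun x : (V × V) × ℝ => (x.1.1, x.2)) (by fun_prop)
  have h2 : Continuous fun x : (V × V) × ℝ => rot x.2 x.1.2 :=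
    continuous_rot.comp (f := fun x : (V × V) × ℝ => (x.1.2, x.2)) (by fun_prop)
  refine continuousOn_line h1.continuousOn h2.continuousOn ?_ ?_ ?_
  · intro x hx
    have := LinearIndependent.map' hx (rot x.2) (LinearMap.ker_eq_bot.2 (rot_injective x.2))
    have e : ![rot x.2 x.1.1, rot x.2 x.1.2] = rot x.2 ∘ ![x.1.1, x.1.2] := by
      ext i : 1; fin_cases i <;> rfl
    rw [e]
    exact this
  · exact fun x hx => Submodule.mem_map_of_mem (mem_spanLine hx).1
  · exact fun x hx => Submodule.mem_map_of_mem (mem_spanLine hx).2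

/-- A basis of the line `gen a b g`: the midpoint of its two points on the sphere and its
direction. -/
def basisPair (b g : ℝ≥0 → ℝ) (a : ℝ≥0) : V × V :=
  (!₂[g a, -(a * (b a / (1 + (a : ℝ) ^ 2))), b a / (1 + (a : ℝ) ^ 2), 1],
    !₂[0, 1 / (1 + (a : ℝ)), a / (1 + (a : ℝ)), 0])

theorem linearIndependent_basisPair (b g : ℝ≥0 → ℝ) (a : ℝ≥0) :
    LinearIndependent ℝ ![(basisPair b g a).1, (basisPair b g a).2] := by
  apply linearIndependent_of_coord
  · simp [basisPair]
  · simp [basisPair]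
  · intro h
    have : 1 / (1 + (a : ℝ)) = 0 := by simpa [basisPair] using congrArg (fun u : V => u 1) h
    have h2 : (0 : ℝ) < 1 / (1 + (a : ℝ)) := by positivity
    exact h2.ne' this

theorem spanLine_basisPair (b g : ℝ≥0 → ℝ) (a : ℝ≥0) :
    spanLine (basisPair b g a) = gen a (b a) (g a) := by
  have hi := linearIndependent_basisPair b g a
  have h0 : (1 : ℝ) + (a : ℝ) ≠ 0 := by positivity
  have h1 : (1 : ℝ) + (a : ℝ) ^ 2 ≠ 0 := by positivity
  refine line_eq_of_mem hi (mem_spanLine hi).1 (mem_spanLine hi).2 ?_ ?_ <;> rw [mem_gen]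
  · refine ⟨by simp [basisPair], ?_⟩
    simp [basisPair]
    field_simp
    ring
  · refine ⟨by simp [basisPair], ?_⟩
    simp [basisPair]
    field_simp

/-- A basis of the axis `Z`. -/
def axisPair : V × V := (!₂[0, 0, 0, 1], !₂[0, 0, 1, 0])

theorem linearIndependent_axisPair : LinearIndependent ℝ ![axisPair.1, axisPair.2] :=
  linearIndependent_of_coord (by simp [axisPair]) (by simp [axisPair]) fun h => by
    simpa [axisPair] using congrArg (fun u : V => u 2) h

theorem spanLine_axisPair : spanLine axisPair = zAxis := by
  have hi := linearIndependent_axisPair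
  refine line_eq_of_mem hi (mem_spanLine hi).1 (mem_spanLine hi).2 ?_ ?_ <;>
    simp [mem_zAxis, axisPair]

theorem continuous_basisPair {b g : ℝ≥0 → ℝ} (hb : Continuous b) (hg : Continuous g) :
    Continuous (basisPair b g) := by
  have h0 : ∀ a : ℝ≥0, (1 : ℝ) + (a : ℝ) ≠ 0 := fun a => by positivity
  have h1 : ∀ a : ℝ≥0, (1 : ℝ) + (a : ℝ) ^ 2 ≠ 0 := fun a => by positivity
  have h2 : Continuous fun a : ℝ≥0 => b a / (1 + (a : ℝ) ^ 2) := hb.div (by fun_prop) h1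
  refine (continuous_vec hg ?_ h2 continuous_const).prodMk
    (continuous_vec continuous_const ?_ ?_ continuous_const)
  · fun_prop
  · exact continuous_const.div (by fun_prop) h0
  · exact NNReal.continuous_coe.div (by fun_prop) h0

/-- Dividing the direction by `1 + a` keeps it bounded with limit `(0, 0, 1, 0)`; the other
coordinates of the midpoint are controlled by `|b/a|`. -/
theorem tendsto_basisPair {b g : ℝ≥0 → ℝ}
    (hbl : Tendsto (fun a : ℝ≥0 => b a / a) atTop (𝓝 0)) (hgl : Tendsto g atTop (𝓝 0)) :
    Tendsto (basisPair b g) atTop (𝓝 axisPair) := by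
  have hinf : Tendsto (fun a : ℝ≥0 => 1 / (1 + (a : ℝ))) atTop (𝓝 0) := by
    apply Tendsto.div_atTop tendsto_const_nhds
    exact tendsto_atTop_add_const_left _ _ (NNReal.tendsto_coe_atTop.2 tendsto_id)
  have hbd : ∀ a : ℝ≥0, 0 < a → |a * (b a / (1 + (a : ℝ) ^ 2))| ≤ |b a / a| ∧
      |b a / (1 + (a : ℝ) ^ 2)| ≤ |b a / a| := by
    intro a ha
    have ha : (0 : ℝ) < a := ha
    have e1 : |(a : ℝ)| = a := abs_of_pos ha
    have e2 : |1 + (a : ℝ) ^ 2| = 1 + (a : ℝ) ^ 2 := abs_of_pos (by positivity)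
    have h0 := abs_nonneg (b a)
    rw [abs_mul, abs_div, abs_div, e1, e2, mul_div_assoc', div_le_div_iff₀ (by positivity) ha,
      div_le_div_iff₀ (by positivity) ha]
    constructor
    · nlinarith
    · nlinarith [sq_nonneg ((a : ℝ) - 1)]
  have e : axisPair = (!₂[0, -0, 0, 1], !₂[0, 0, 1, 0]) := by rw [neg_zero]; rfl
  rw [e]
  have hbl' := hbl.abs
  rw [abs_zero] at hbl'
  refine (tendsto_vec hgl (Tendsto.neg ?_) ?_ tendsto_const_nhds).prodMk_nhds
    (tendsto_vec tendsto_const_nhds hinf ?_ tendsto_const_nhds)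
  · refine squeeze_zero_norm' ?_ hbl'
    filter_upwards [eventually_gt_atTop 0] with a ha using (hbd a ha).1
  · refine squeeze_zero_norm' ?_ hbl'
    filter_upwards [eventually_gt_atTop 0] with a ha using (hbd a ha).2
  · have := hinf.const_sub 1
    rw [sub_zero] at this
    refine this.congr fun a => ?_
    have h0 : (1 : ℝ) + (a : ℝ) ≠ 0 := by positivity
    field_simp
    ring

/-- The curve of bases becomes compact on adding its limit, a basis of `Z`; the family is the
continuous image of this compact set times `[0, 2π]`. -/
theorem isCompact_rotStar {b g : ℝ≥0 → ℝ} (hb : Continuous b) (hg : Continuous g)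
    (hbl : Tendsto (fun a : ℝ≥0 => b a / a) atTop (𝓝 0)) (hgl : Tendsto g atTop (𝓝 0)) :
    IsCompact (rotStar b g) := by
  have hK := Tendsto.isCompact_insert_range_of_cocompact (f := basisPair b g) (y := axisPair)
    (by rw [cocompact_eq_atTop]; exact tendsto_basisPair hbl hgl) (continuous_basisPair hb hg)
  have himg := (hK.prod (isCompact_Icc (a := (0 : ℝ)) (b := 2 * Real.pi))).image_of_continuousOn
    (continuousOn_rotLine_spanLine.mono (by
      rintro ⟨p, θ⟩ ⟨rfl | ⟨a, rfl⟩, -⟩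
      · exact linearIndependent_axisPair
      · exact linearIndependent_basisPair b g a))
  convert himg using 1
  ext L
  constructor
  · rintro (rfl | ⟨θ, a, rfl⟩)
    · refine ⟨(axisPair, 0),
        ⟨Or.inl rfl, left_mem_Icc.2 Real.two_pi_pos.le⟩, ?_⟩
      simp only [spanLine_axisPair, rotLine_zero]
    · obtain ⟨η, hη, he⟩ :=
        (rotLine_periodic (gen a (b a) (g a))).exists_mem_Ico₀ Real.two_pi_pos θ
      refine ⟨(basisPair b g a, η), ⟨Or.inr ⟨a, rfl⟩, Ico_subset_Icc_self hη⟩, ?_⟩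
      simp only [spanLine_basisPair]
      exact he.symm
  · rintro ⟨⟨p, θ⟩, ⟨rfl | ⟨a, rfl⟩, -⟩, rfl⟩
    · left; simp only [spanLine_axisPair, rotLine_zAxis]
    · right; exact ⟨θ, a, by simp only [spanLine_basisPair]⟩

/-! ### Homeomorphisms from `[0, ∞)` onto `[0, 1)`. -/

section Homeo

variable (t : ℝ≥0 ≃ₜ Ico (0 : ℝ) 1)

theorem continuous_coe_homeo : Continuous fun a => (t a : ℝ) :=
  continuous_subtype_val.comp t.continuous

theorem strictMono_homeo : StrictMono t := by
  refine (t.continuous.strictMono_of_inj t.injective).resolve_right fun h => ?_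
  have h1 := (t 0).2.2
  -- If `t` were decreasing, `t 0` would be a maximum of `[0, 1)`; the midpoint of `t 0` and `1` is
  -- larger.
  obtain ⟨a, ha⟩ := t.surjective ⟨((t 0 : ℝ) + 1) / 2, by
    have := (t 0).2.1
    constructor <;> linarith⟩
  have h2 : (t a : ℝ) ≤ t 0 := h.antitone (zero_le : 0 ≤ a)
  rw [ha] at h2
  change ((t 0 : ℝ) + 1) / 2 ≤ t 0 at h2
  linarith

theorem homeo_zero : (t 0 : ℝ) = 0 := by
  obtain ⟨a, ha⟩ := t.surjective ⟨0, by simp⟩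
  have h2 : (t 0 : ℝ) ≤ t a := (strictMono_homeo t).monotone (zero_le : 0 ≤ a)
  rw [ha] at h2
  exact le_antisymm h2 (t 0).2.1

theorem homeo_pos {a : ℝ≥0} (ha : 0 < a) : 0 < (t a : ℝ) := by
  exact (homeo_zero t).symm.trans_lt (strictMono_homeo t ha)

theorem tendsto_homeo : Tendsto (fun a => (t a : ℝ)) atTop (𝓝 1) := by
  rw [tendsto_order]
  constructor
  · intro r hr
    obtain ⟨a, ha⟩ := t.surjective ⟨max r 0, le_max_right _ _, max_lt hr one_pos⟩
    filter_upwards [eventually_gt_atTop a] with x hx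
    have : (t a : ℝ) < t x := strictMono_homeo t hx
    rw [ha] at this
    exact (le_max_left r 0).trans_lt this
  · intro r hr
    exact Eventually.of_forall fun x => (t x).2.2.trans hr

end Homeo

/-! ### Admissible pairs yield topological gl stars. -/

section AdmissiblePair

variable {t s : ℝ≥0 ≃ₜ Ico (0 : ℝ) 1}

/-- The radicand in the definition of `coeffC`. -/
def radicand (t s : ℝ≥0 ≃ₜ Ico (0 : ℝ) 1) (a : ℝ≥0) : ℝ :=
  (a : ℝ) ^ 2 - ((a : ℝ) ^ 2 + 1) *
    ((((t a : ℝ) + s a) / 2) ^ 2 + (a : ℝ) ^ 2 * (((t a : ℝ) - s a) / 2) ^ 2)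

theorem radicand_nonneg_iff (a : ℝ≥0) : 0 ≤ radicand t s a ↔
    ((a : ℝ) ^ 2 + 1) * (((t a : ℝ) - s a) / 2) ^ 2
      ≤ (a : ℝ) ^ 2 / ((a : ℝ) ^ 2 + 1) - (t a : ℝ) * s a := by
  have h1 : (0 : ℝ) < (a : ℝ) ^ 2 + 1 := by positivity
  have : radicand t s a = ((a : ℝ) ^ 2 + 1) * ((a : ℝ) ^ 2 / ((a : ℝ) ^ 2 + 1) - (t a : ℝ) * s a -
      ((a : ℝ) ^ 2 + 1) * (((t a : ℝ) - s a) / 2) ^ 2) := by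
    unfold radicand
    field_simp
    ring
  rw [this, mul_nonneg_iff_of_pos_left h1, sub_nonneg]

theorem radicand_zero : radicand t s 0 = 0 := by
  simp [radicand, homeo_zero]

theorem continuous_h (x z : ℝ) : Continuous (h t s x z) := by
  have ht := continuous_coe_homeo t
  have hs := continuous_coe_homeo s
  unfold h
  fun_prop

theorem h_eq_surface (x z : ℝ) (a : ℝ≥0) :
    h t s x z a = (a : ℝ) ^ 2 * x ^ 2 - (z - coeffB t s a) ^ 2 - radicand t s a := by
  unfold h radicand coeffB; ring

theorem onSurface_iff {a : ℝ≥0} {g x z : ℝ} {v : V} (hg : (a * g) ^ 2 = radicand t s a)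
    (hv : v 3 ≠ 0) (hx : v 0 ^ 2 + v 1 ^ 2 = x ^ 2 * v 3 ^ 2) (hz : v 2 = z * v 3) :
    OnSurface a (coeffB t s a) g v ↔ h t s x z a = 0 := by
  unfold OnSurface
  rw [hx, hz, mul_pow, hg, h_eq_surface, ← sub_eq_zero]
  constructor
  · intro h
    apply mul_left_cancel₀ (pow_ne_zero 2 hv)
    linear_combination h
  · intro h
    linear_combination v 3 ^ 2 * h

theorem h_zero (x z : ℝ) : h t s x z 0 = -z ^ 2 := by
  simp [h, homeo_zero]

/-- Intermediate values: `h` starts at `-z² < 0`, and since `t, s → 1` it grows like `a² x²`. -/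
theorem exists_root {x z : ℝ} (hx : x ≠ 0) (hz : z ≠ 0) : ∃ a : ℝ≥0, 0 < a ∧ h t s x z a = 0 := by
  have hlim : Tendsto (h t s x z) atTop atTop := by
    have ht := tendsto_homeo t
    have hs := tendsto_homeo s
    have h1 : Tendsto (fun a : ℝ≥0 => x ^ 2 - 1 + ((t a : ℝ) - s a) * z + (t a : ℝ) * s a) atTop
        (𝓝 (x ^ 2 - 1 + (1 - 1) * z + 1 * 1)) :=
      (tendsto_const_nhds.add ((ht.sub hs).mul_const z)).add (ht.mul hs)
    have h2 : Tendsto (fun a : ℝ≥0 => (a : ℝ) ^ 2 + 1) atTop atTop :=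
      tendsto_atTop_add_const_right _ _
        ((tendsto_pow_atTop two_ne_zero).comp (NNReal.tendsto_coe_atTop.2 tendsto_id))
    have h3 := tendsto_atTop_add_const_right _ (1 - x ^ 2 - z ^ 2)
      (h2.atTop_mul_pos (by ring_nf; positivity) h1)
    refine h3.congr fun a => ?_
    unfold h; ring
  obtain ⟨a₁, ha₁⟩ := (hlim.eventually_ge_atTop 0).exists
  obtain ⟨a, ha⟩ := mem_range_of_exists_le_of_exists_ge (continuous_h (t := t) (s := s) x z)
    ⟨0, by rw [h_zero]; nlinarith [sq_nonneg z]⟩ ⟨a₁, ha₁⟩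
  refine ⟨a, ?_, ha⟩
  rw [pos_iff_ne_zero]
  rintro rfl
  rw [h_zero] at ha
  exact hz (by simpa using ha)

/-- This settles the points of the plane `z = 0`, about which condition (3) says nothing: only `a =
0` reaches them. -/
theorem h_pos {x : ℝ} (hx : 1 ≤ x ^ 2) {a : ℝ≥0} (ha : 0 < a) : 0 < h t s x 0 a := by
  have h1 : 0 < (t a : ℝ) * s a := mul_pos (homeo_pos t ha) (homeo_pos s ha)
  have : h t s x 0 a = (a : ℝ) ^ 2 * (x ^ 2 - 1) + ((a : ℝ) ^ 2 + 1) * ((t a : ℝ) * s a) := by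
    unfold h; ring
  rw [this]
  have : 0 ≤ (a : ℝ) ^ 2 * (x ^ 2 - 1) := mul_nonneg (by positivity) (by linarith)
  positivity

theorem h_add (x z : ℝ) (a : ℝ≥0) : h t s x z a = h t s 0 z a + (a : ℝ) ^ 2 * x ^ 2 := by
  unfold h; ring

/-- No cone of the family has its vertex on the axis outside the sphere: otherwise the maximum
of `h 0 z` would split into two roots of `h x z` for small `x > 0`. -/
theorem h_axis_ne_zero (H : AdmissiblePair t s) {z : ℝ} (hz : 1 ≤ z ^ 2) {a : ℝ≥0} (ha : 0 < a) :
    h t s 0 z a ≠ 0 := by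
  intro h0
  have hz0 : z ≠ 0 := by rintro rfl; norm_num at hz
  -- At `x = 0` one has `h = -(z - b)² - c² ≤ 0`, so (3) makes `a` the only zero and a strict
  -- maximum.
  have hneg : ∀ a' : ℝ≥0, 0 < a' → a' ≠ a → h t s 0 z a' < 0 := by
    intro a' ha' hne
    have hr := (radicand_nonneg_iff a').2 (H.ineq a' ha')
    refine lt_of_le_of_ne ?_ fun h => hne ?_
    · rw [h_eq_surface]
      nlinarith [sq_nonneg (z - coeffB t s a')]
    · exact H.root 0 z le_rfl hz0 (by simpa using hz) ⟨ha', h⟩ ⟨ha, h0⟩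
  have ha1 : a / 2 < a := NNReal.half_lt_self ha.ne'
  have ha2 : a < a + 1 := lt_add_one a
  have n1 := hneg (a / 2) (half_pos ha) ha1.ne
  have n2 := hneg (a + 1) (ha.trans ha2) ha2.ne'
  have hc : ∀ a' : ℝ≥0, h t s 0 z a' < 0 → ∀ᶠ x in 𝓝 (0 : ℝ), h t s x z a' < 0 := by
    intro a' h'
    have : Continuous fun x => h t s x z a' := by unfold h; fun_prop
    exact (this.tendsto 0).eventually_lt_const h'
  obtain ⟨x, ⟨hx1, hx2⟩, hx⟩ := ((((hc _ n1).and (hc _ n2)).filter_mono nhdsWithin_le_nhds).and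
    (self_mem_nhdsWithin : Ioi (0 : ℝ) ∈ 𝓝[>] 0)).exists
  have hx : 0 < x := hx
  have hpos : 0 < h t s x z a := by
    rw [h_add, h0, zero_add]
    have : (0 : ℝ) < a := ha
    positivity
  obtain ⟨r₁, hr₁, e₁⟩ := intermediate_value_Icc ha1.le
    (continuous_h (t := t) (s := s) x z).continuousOn ⟨hx1.le, hpos.le⟩
  obtain ⟨r₂, hr₂, e₂⟩ := intermediate_value_Icc' ha2.le
    (continuous_h (t := t) (s := s) x z).continuousOn ⟨hx2.le, hpos.le⟩
  -- The two roots lie on either side of `a`; being equal by (3) they are `a`, where `h` is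
  -- positive.
  have he := H.root x z hx.le hz0 (by nlinarith [sq_nonneg x])
    ⟨(half_pos ha).trans_le hr₁.1, e₁⟩ ⟨ha.trans_le hr₂.1, e₂⟩
  have : r₁ = a := le_antisymm hr₁.2 (he ▸ hr₂.1)
  rw [this] at e₁
  exact hpos.ne' e₁

theorem existsUnique_onSurface (H : AdmissiblePair t s) {g : ℝ≥0 → ℝ}
    (hg : ∀ a : ℝ≥0, (a * g a) ^ 2 = radicand t s a) {v : V} (hv : v 0 ≠ 0 ∨ v 1 ≠ 0)
    (hQ : 0 ≤ Q v) : ∃! a : ℝ≥0, OnSurface a (coeffB t s a) (g a) v := by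
  have hn : 0 < v 0 ^ 2 + v 1 ^ 2 := by
    rcases hv with h | h <;> positivity
  by_cases h3 : v 3 = 0
  · have key : ∀ a : ℝ≥0, OnSurface a (coeffB t s a) (g a) v ↔
        (a : ℝ) = √(v 2 ^ 2 / (v 0 ^ 2 + v 1 ^ 2)) := by
      intro a
      rw [eq_comm, Real.sqrt_eq_iff_eq_sq (by positivity) a.coe_nonneg, div_eq_iff hn.ne']
      unfold OnSurface
      rw [h3]
      constructor <;> intro h <;> linear_combination -h
    refine ⟨⟨√(v 2 ^ 2 / (v 0 ^ 2 + v 1 ^ 2)), Real.sqrt_nonneg _⟩, (key _).2 rfl, ?_⟩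
    intro a ha
    exact NNReal.eq ((key a).1 ha)
  · obtain ⟨x, hx0, hx⟩ : ∃ x : ℝ, 0 < x ∧ v 0 ^ 2 + v 1 ^ 2 = x ^ 2 * v 3 ^ 2 :=
      ⟨√((v 0 ^ 2 + v 1 ^ 2) / v 3 ^ 2), by positivity, by
        rw [Real.sq_sqrt (by positivity)]; field_simp⟩
    obtain ⟨z, hz⟩ : ∃ z : ℝ, v 2 = z * v 3 := ⟨v 2 / v 3, by field_simp⟩
    have hxz : 1 ≤ x ^ 2 + z ^ 2 := by
      have : 0 ≤ (x ^ 2 + z ^ 2 - 1) * v 3 ^ 2 := by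
        unfold Q at hQ; rw [hz] at hQ; linarith
      have := nonneg_of_mul_nonneg_left this (by positivity)
      linarith
    simp only [fun a => onSurface_iff (hg a) h3 hx hz]
    by_cases hz0 : z = 0
    · subst hz0
      refine ⟨0, by simp [h_zero], fun a ha => ?_⟩
      by_contra h0
      exact (h_pos (t := t) (s := s) (by simpa using hxz) (pos_iff_ne_zero.2 h0)).ne' ha
    · obtain ⟨a, ha, hr⟩ := exists_root (t := t) (s := s) hx0.ne' hz0
      refine ⟨a, hr, fun a' hr' => ?_⟩
      have ha' : 0 < a' := by
        rw [pos_iff_ne_zero]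
        rintro rfl
        simp only [h_zero] at hr'
        exact hz0 (by simpa using hr')
      exact H.root x z hx0.le hz0 hxz ⟨ha', hr'⟩ ⟨ha, hr⟩

theorem not_onSurface_axis (H : AdmissiblePair t s) {g : ℝ≥0 → ℝ}
    (hg : ∀ a : ℝ≥0, (a * g a) ^ 2 = radicand t s a) {v : V} (h0 : v 0 = 0) (h1 : v 1 = 0)
    (h2 : v 2 ≠ 0) (hQ : 0 ≤ Q v) (a : ℝ≥0) : ¬ OnSurface a (coeffB t s a) (g a) v := by
  by_cases h3 : v 3 = 0
  · unfold OnSurface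
    rw [h0, h1, h3]
    intro h
    exact h2 (pow_eq_zero_iff two_ne_zero |>.1 (by linarith))
  · have hz : v 2 = v 2 / v 3 * v 3 := by field_simp
    rw [onSurface_iff (hg a) h3 (x := 0) (by rw [h0, h1]; ring) hz]
    have hz2 : 1 ≤ (v 2 / v 3) ^ 2 := by
      rw [div_pow, one_le_div (by positivity)]
      unfold Q at hQ
      rw [h0, h1] at hQ
      linarith
    rcases eq_zero_or_pos a with rfl | ha
    · rw [h_zero]
      have : v 2 / v 3 ≠ 0 := div_ne_zero h2 h3
      simpa using ⟨h2, h3⟩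
    · exact h_axis_ne_zero H hz2 ha

theorem AdmissiblePair.coeffC_sq (H : AdmissiblePair t s) (a : ℝ≥0) :
    coeffC t s a ^ 2 = radicand t s a := by
  refine Real.sq_sqrt ?_
  change 0 ≤ radicand t s a
  rcases eq_zero_or_pos a with rfl | ha
  · rw [radicand_zero]
  · exact (radicand_nonneg_iff a).2 (H.ineq a ha)

theorem coeffC_zero : coeffC t s 0 = 0 := by
  change √(radicand t s 0) = 0
  rw [radicand_zero, Real.sqrt_zero]

theorem coeffB_zero : coeffB t s 0 = 0 := by
  simp [coeffB, homeo_zero]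

theorem continuous_coeffB : Continuous (coeffB t s) := by
  have ht := continuous_coe_homeo t
  have hs := continuous_coe_homeo s
  unfold coeffB
  fun_prop

theorem continuous_coeffC : Continuous (coeffC t s) := by
  have ht := continuous_coe_homeo t
  have hs := continuous_coe_homeo s
  unfold coeffC
  fun_prop

/-- Power of a point: from the trace in `z = 0` the sphere points at heights `t` and `-s` have
distances `t√(1 + 1/a²)` and `s√(1 + 1/a²)`. -/
theorem AdmissiblePair.sq_add_sq (H : AdmissiblePair t s) {a : ℝ≥0} (ha : 0 < a) :
    (coeffC t s a / a) ^ 2 + (coeffB t s a / a) ^ 2 = 1 - (1 + 1 / (a : ℝ) ^ 2) * (t a * s a) := by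
  have ha' : (a : ℝ) ≠ 0 := by exact_mod_cast ha.ne'
  rw [div_pow, H.coeffC_sq]
  unfold radicand coeffB
  field_simp
  ring

/-- Condition (1) enters here: `(c/a)² = 1 - (a² + 1)(((t + s)/2a)² + ((t - s)/2)²)` tends to `1 -
1`. -/
theorem AdmissiblePair.tendsto_coeffC_div (H : AdmissiblePair t s) :
    Tendsto (fun a : ℝ≥0 => coeffC t s a / a) (𝓝 0) (𝓝 0) := by
  have ht := (continuous_coe_homeo t).tendsto 0
  have hs := (continuous_coe_homeo s).tendsto 0
  rw [homeo_zero] at ht hs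
  have hc : Tendsto (fun a : ℝ≥0 => (a : ℝ)) (𝓝 0) (𝓝 0) := NNReal.continuous_coe.tendsto 0
  have h1 : Tendsto (fun a : ℝ≥0 => √(1 - ((a : ℝ) ^ 2 + 1) *
      ((((t a : ℝ) + s a) / (2 * a)) ^ 2 + (((t a : ℝ) - s a) / 2) ^ 2))) (𝓝[≠] 0)
      (𝓝 (√(1 - ((0 : ℝ) ^ 2 + 1) * (1 ^ 2 + ((0 - 0) / 2) ^ 2)))) := by
    have k1 := ((hc.pow 2).add_const 1).mono_left (nhdsWithin_le_nhds (s := {0}ᶜ))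
    have k2 := (((ht.sub hs).div_const 2).pow 2).mono_left (nhdsWithin_le_nhds (s := {0}ᶜ))
    exact ((k1.mul ((H.tendsto.pow 2).add k2)).const_sub 1).sqrt
  have h2 : Tendsto (fun a : ℝ≥0 => coeffC t s a / a) (𝓝[≠] 0) (𝓝 0) := by
    have e : √(1 - ((0 : ℝ) ^ 2 + 1) * (1 ^ 2 + ((0 - 0) / 2) ^ 2)) = 0 := by norm_num
    rw [e] at h1
    refine h1.congr' ?_
    filter_upwards [self_mem_nhdsWithin] with a ha
    have ha0 : a ≠ 0 := ha
    have ha' : (0 : ℝ) < a := NNReal.coe_pos.2 (pos_iff_ne_zero.2 ha0)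
    rw [← Real.sqrt_sq (div_nonneg (Real.sqrt_nonneg _) ha'.le : 0 ≤ coeffC t s a / a),
      div_pow (coeffC t s a), H.coeffC_sq]
    congr 1
    unfold radicand
    field_simp
  -- The value at `0` is `0` by the convention for division by zero, so the punctured limit is
  -- enough.
  rw [← pure_sup_nhdsNE, tendsto_sup]
  refine ⟨?_, h2⟩
  rw [tendsto_pure_left]
  intro u hu
  simpa using mem_of_mem_nhds hu

theorem intUnit_cast_sq (ε : ℤˣ) : ((ε : ℤ) : ℝ) ^ 2 = 1 := by
  rcases Int.units_eq_one_or ε with rfl | rfl <;> simp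

/-- The signed parameter `±c(a) / a`. -/
def signedRadius (t s : ℝ≥0 ≃ₜ Ico (0 : ℝ) 1) (ε : ℝ≥0 → ℤˣ) (a : ℝ≥0) : ℝ :=
  ((ε a : ℤ) : ℝ) * (coeffC t s a / a)

theorem abs_signedRadius (ε : ℝ≥0 → ℤˣ) (a : ℝ≥0) :
    |signedRadius t s ε a| = coeffC t s a / a := by
  have h0 : 0 ≤ coeffC t s a / a := div_nonneg (Real.sqrt_nonneg _) a.2
  unfold signedRadius
  rcases Int.units_eq_one_or (ε a) with h | h <;> simp [h, abs_of_nonneg h0]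

/-- Signs are harmless where `c/a` vanishes; elsewhere the admissible choice is locally constant. -/
theorem continuous_signedRadius (H : AdmissiblePair t s) {ε : ℝ≥0 → ℤˣ}
    (hε : AdmissibleChoice (coeffC t s) ε) : Continuous (signedRadius t s ε) := by
  have hC : ∀ a₀ : ℝ≥0, Tendsto (fun a : ℝ≥0 => coeffC t s a / a) (𝓝 a₀)
      (𝓝 (coeffC t s a₀ / a₀)) := by
    intro a₀
    rcases eq_or_ne a₀ 0 with rfl | h0
    · simpa using H.tendsto_coeffC_div
    · exact (continuous_coeffC.tendsto a₀).div (NNReal.continuous_coe.tendsto a₀)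
        (by exact_mod_cast h0)
  rw [continuous_iff_continuousAt]
  intro a₀
  by_cases hc0 : coeffC t s a₀ / a₀ = 0
  · have h0 : signedRadius t s ε a₀ = 0 := by rw [signedRadius, hc0, mul_zero]
    unfold ContinuousAt
    rw [h0]
    have := hC a₀
    rw [hc0] at this
    exact squeeze_zero_norm (fun a => (abs_signedRadius ε a).le) this
  · have hne : coeffC t s a₀ ≠ 0 := fun h => hc0 (by rw [h, zero_div])
    have ha₀ : 0 < a₀ := by
      rw [pos_iff_ne_zero]; rintro rfl; exact hne coeffC_zero
    have hnhds : {a : ℝ≥0 | coeffC t s a ≠ 0} ∈ 𝓝 a₀ :=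
      (isOpen_ne_fun continuous_coeffC continuous_const).mem_nhds hne
    obtain ⟨l, u, hlu, hsub⟩ := (mem_nhds_iff_exists_Ioo_subset' ⟨0, ha₀⟩
      ⟨a₀ + 1, lt_add_one a₀⟩).1 hnhds
    have hconst : ∀ᶠ a in 𝓝 a₀, ε a = ε a₀ := by
      filter_upwards [Ioo_mem_nhds hlu.1 hlu.2] with a ha
      rcases le_total a a₀ with h | h
      · exact hε a a₀ (lt_of_le_of_lt zero_le ha.1) h fun x hx =>
          hsub ⟨ha.1.trans_le hx.1, hx.2.trans_lt hlu.2⟩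
      · exact (hε a₀ a ha₀ h fun x hx =>
          hsub ⟨hlu.1.trans_le hx.1, hx.2.trans_lt ha.2⟩).symm
    refine ((hC a₀).const_mul ((ε a₀ : ℤ) : ℝ)).congr' ?_
    filter_upwards [hconst] with a ha
    rw [signedRadius, ha]

theorem AdmissiblePair.star_properties (H : AdmissiblePair t s) {ε : ℝ≥0 → ℤˣ}
    (hε : AdmissibleChoice (coeffC t s) ε) :
    IsGLStar (star (coeffB t s) (coeffC t s) ε) ∧ IsTopological (star (coeffB t s) (coeffC t s) ε) ∧
      IsRotational (star (coeffB t s) (coeffC t s) ε) := by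
  set g := signedRadius t s ε with hgdef
  have hg0 : g 0 = 0 := by simp [hgdef, signedRadius]
  have hca : ∀ a : ℝ≥0, a * (coeffC t s a / a) = coeffC t s a := by
    intro a
    rcases eq_or_ne a 0 with rfl | h0
    · simp [coeffC_zero]
    · have : (a : ℝ) ≠ 0 := by exact_mod_cast h0
      field_simp
  have hgsq : ∀ a : ℝ≥0, g a ^ 2 = (coeffC t s a / a) ^ 2 := fun a => by
    rw [← abs_signedRadius ε a, sq_abs]
  have hg : ∀ a : ℝ≥0, (a * g a) ^ 2 = radicand t s a := fun a => by
    rw [mul_pow, hgsq, ← mul_pow, hca, H.coeffC_sq]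
  have hstar : star (coeffB t s) (coeffC t s) ε = rotStar (coeffB t s) g := by
    refine star_eq_rotStar coeffB_zero hg0 (fun a => ?_) fun a ha h0 => ?_
    · rw [abs_signedRadius, hca]
    · have e : ((ε a : ℤ) : ℝ) * g a = coeffC t s a / a := by
        rw [hgdef, signedRadius, ← mul_assoc, ← pow_two, intUnit_cast_sq, one_mul]
      rw [e, ← abs_signedRadius ε a]
      exact abs_pos.2 h0
  have hin : ∀ a : ℝ≥0, g a ^ 2 + (coeffB t s a / a) ^ 2 < 1 := by
    intro a
    rcases eq_zero_or_pos a with rfl | ha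
    · simp [hg0]
    · rw [hgsq, H.sq_add_sq ha]
      have := mul_pos (homeo_pos t ha) (homeo_pos s ha)
      have : 0 < (1 + 1 / (a : ℝ) ^ 2) * ((t a : ℝ) * s a) := by positivity
      linarith
  -- As `t, s → 1`, the power of the trace point tends to `1`, so the trace tends to the origin.
  have hlim : Tendsto (fun a : ℝ≥0 => g a ^ 2 + (coeffB t s a / a) ^ 2) atTop (𝓝 0) := by
    have h1 : Tendsto (fun a : ℝ≥0 => 1 / (a : ℝ) ^ 2) atTop (𝓝 0) :=
      tendsto_const_nhds.div_atTop
        ((tendsto_pow_atTop two_ne_zero).comp (NNReal.tendsto_coe_atTop.2 tendsto_id))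
    have h2 := ((h1.const_add 1).mul ((tendsto_homeo t).mul (tendsto_homeo s))).const_sub 1
    norm_num at h2
    refine h2.congr' ?_
    filter_upwards [eventually_gt_atTop 0] with a ha
    rw [hgsq, H.sq_add_sq ha]
    norm_num
  have hlim' := hlim.sqrt
  rw [Real.sqrt_zero] at hlim'
  have hstarG : IsGLStar (rotStar (coeffB t s) g) :=
    isGLStar_rotStar coeffB_zero hg0 hin (fun v => existsUnique_onSurface H hg)
      (fun v => not_onSurface_axis H hg)
  rw [hstar]
  refine ⟨hstarG, isTopological_of_isCompact (isCompact_rotStar continuous_coeffB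
    (continuous_signedRadius H hε) ?_ ?_) hstarG.existsUnique, isRotational_rotStar _ _⟩
  · exact squeeze_zero_norm (fun a => Real.abs_le_sqrt (le_add_of_nonneg_left (sq_nonneg _))) hlim'
  · exact squeeze_zero_norm (fun a => Real.abs_le_sqrt (le_add_of_nonneg_right (sq_nonneg _))) hlim'

end AdmissiblePair

/-! ### Converse: a rotational gl star containing `X` is some `rotStar b g`. -/

theorem IsGLStar.eq_of_mem {S : Set Line} (hS : IsGLStar S) {v : V} (hv : v ≠ 0) (hQ : 0 ≤ Q v)
    {L M : Line} (hL : L ∈ S) (hM : M ∈ S) (hvL : v ∈ L.1) (hvM : v ∈ M.1) : L = M :=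
  ((isGLStar_iff.1 hS).2 v hv hQ).unique ⟨hL, hvL⟩ ⟨hM, hvM⟩

theorem IsTwoSecant.exists_affine {L : Line} (hL : IsTwoSecant L) : ∃ w ∈ L.1, w 3 ≠ 0 := by
  obtain ⟨p, q, -, hset⟩ := Set.ncard_eq_two.1 hL
  have hp : p ∈ ({p, q} : Set Point) := by simp
  rw [← hset] at hp
  obtain ⟨w, hw, rfl⟩ := exists_eq_pt p
  obtain ⟨hs, hi⟩ := hp
  rw [pt_mem_sphere] at hs
  refine ⟨w, (incident_pt hw).1 hi, fun h3 => hw ((eq_zero_iff w).2 ?_)⟩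
  unfold Q at hs
  rw [h3] at hs
  refine ⟨?_, ?_, ?_, h3⟩ <;> nlinarith [sq_nonneg (w 0), sq_nonneg (w 1), sq_nonneg (w 2)]

section Converse

variable {S : Set Line}

/-- The line through the vertical point at infinity is invariant under the half turn; an affine
point of it plus its image lies on `Z`. -/
theorem zAxis_mem (hS : IsGLStar S) (hR : IsRotational S) : zAxis ∈ S := by
  have hi3 : (!₂[0, 0, 1, 0] : V) ≠ 0 := fun h => by simpa using congrArg (fun u : V => u 2) h
  have hQ : 0 ≤ Q !₂[0, 0, 1, 0] := by simp [Q]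
  obtain ⟨L, ⟨hL, he⟩, -⟩ := (isGLStar_iff.1 hS).2 _ hi3 hQ
  have hrot : rotLine Real.pi L = L := by
    refine hS.eq_of_mem hi3 hQ (hR _ _ hL) hL ?_ he
    rw [mem_rotLine]
    simpa using he
  obtain ⟨w, hw, hw3⟩ := (hS.twoSecant L hL).exists_affine
  have hw' := hw
  rw [← hrot, mem_rotLine] at hw'
  have hsum := L.1.add_mem hw hw'
  suffices h : zAxis = L by rw [h]; exact hL
  refine line_eq_of_mem (linearIndependent_of_coord ?_ ?_ hi3) ?_ ?_ hsum he
  · simpa using hw3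
  · simp
  · simp [mem_zAxis]
  · simp [mem_zAxis]

theorem rotLine_gen_zero_mem (hR : IsRotational S) (hX : xAxis ∈ S) (θ : ℝ) :
    rotLine θ (gen 0 0 0) ∈ S := by
  rw [rotLine_gen_zero]
  exact hR _ _ hX

theorem exists_gen_mem (hS : IsGLStar S) (hR : IsRotational S) {a : ℝ} (ha : 0 < a) :
    ∃ b g : ℝ, gen a b g ∈ S := by
  have h0 : (!₂[0, 1, a, 0] : V) ≠ 0 := fun h => by simpa using congrArg (fun u : V => u 1) h
  have hQ : 0 ≤ Q !₂[0, 1, a, 0] := by simp [Q]; positivity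
  obtain ⟨L, ⟨hL, hd⟩, -⟩ := (isGLStar_iff.1 hS).2 _ h0 hQ
  obtain ⟨w, hw, hw3⟩ := (hS.twoSecant L hL).exists_affine
  obtain ⟨θ, a', b, g, ha', rfl⟩ := exists_eq_rotLine_gen hd (by simp) (by simpa using ha.ne')
    (Or.inr (by simp)) hw hw3
  have e := onSurface_of_mem hd
  simp [OnSurface] at e
  have haa : a' = a := (pow_left_inj₀ ha'.le ha.le two_ne_zero).1 (by linarith)
  refine ⟨b, g, ?_⟩
  have := hR (-θ) _ hL
  rwa [rotLine_rotLine, neg_add_cancel, rotLine_zero, haa] at this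

/-- Points at infinity are not interior, so a line of `S` is determined by its point at infinity.
Off `Z` that point lies on a rotated `gen a b g` in `S`, with `a` its absolute slope. -/
theorem exists_eq_rotStar (hS : IsGLStar S) (hR : IsRotational S) (hX : xAxis ∈ S) :
    ∃ b g : ℝ≥0 → ℝ, b 0 = 0 ∧ g 0 = 0 ∧ S = rotStar b g := by
  have h : ∀ a : ℝ≥0, ∃ b g : ℝ, gen a b g ∈ S ∧ (a = 0 → b = 0 ∧ g = 0) := by
    intro a
    rcases eq_zero_or_pos a with rfl | ha
    · refine ⟨0, 0, ?_, fun _ => ⟨rfl, rfl⟩⟩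
      have := rotLine_gen_zero_mem hR hX 0
      rwa [rotLine_zero] at this
    · obtain ⟨b, g, h⟩ := exists_gen_mem hS hR (a := a) ha
      exact ⟨b, g, h, fun h0 => absurd h0 ha.ne'⟩
  choose b g hbg h0 using h
  obtain ⟨hb0, hg0⟩ := h0 0 rfl
  refine ⟨b, g, hb0, hg0, Subset.antisymm (fun L hL => ?_) ?_⟩
  · obtain ⟨d, hd, hd0, hd3⟩ := exists_mem_coord_eq_zero L 3
    have hQ : 0 ≤ Q d := by unfold Q; rw [hd3]; ring_nf; positivity
    by_cases h01 : d 0 = 0 ∧ d 1 = 0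
    · exact Or.inl (hS.eq_of_mem hd0 hQ hL (zAxis_mem hS hR) hd (mem_zAxis.2 h01))
    · have hn : 0 < d 0 ^ 2 + d 1 ^ 2 := by
        have : d 0 ≠ 0 ∨ d 1 ≠ 0 := by tauto
        rcases this with h | h <;> positivity
      obtain ⟨a, ha⟩ : ∃ a : ℝ≥0, (a : ℝ) ^ 2 = d 2 ^ 2 / (d 0 ^ 2 + d 1 ^ 2) :=
        ⟨⟨√(d 2 ^ 2 / (d 0 ^ 2 + d 1 ^ 2)), Real.sqrt_nonneg _⟩, Real.sq_sqrt (by positivity)⟩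
      have hs : OnSurface a (b a) (g a) d := by
        unfold OnSurface
        rw [ha, hd3]
        field_simp
        ring
      obtain ⟨θ, hθ⟩ := exists_mem_rotLine_gen (coe_ne_zero_or hb0 hg0 a) hs
      exact Or.inr ⟨θ, a, hS.eq_of_mem hd0 hQ hL (hR _ _ (hbg a)) hd hθ⟩
  · rintro L (rfl | ⟨θ, a, rfl⟩)
    · exact zAxis_mem hS hR
    · exact hR _ _ (hbg a)

end Converse

theorem gen_mem_rotStar (b g : ℝ≥0 → ℝ) (a : ℝ≥0) : gen a (b a) (g a) ∈ rotStar b g :=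
  Or.inr ⟨0, a, (rotLine_zero _).symm⟩

/-! ### Converse: continuity of the parameters and heights on the sphere. -/

section RotStar

variable {b g : ℝ≥0 → ℝ}

theorem onSurface_unique (hS : IsGLStar (rotStar b g)) (hb : b 0 = 0) (hg : g 0 = 0) {v : V}
    (hv : v ≠ 0) (hQ : 0 ≤ Q v) {a a' : ℝ≥0} (h : OnSurface a (b a) (g a) v)
    (h' : OnSurface a' (b a') (g a') v) : a = a' := by
  obtain ⟨θ, hθ⟩ := exists_mem_rotLine_gen (coe_ne_zero_or hb hg a) h
  obtain ⟨η, hη⟩ := exists_mem_rotLine_gen (coe_ne_zero_or hb hg a') h'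
  exact NNReal.eq (slope_eq a.2 a'.2
    (hS.eq_of_mem hv hQ (Or.inr ⟨θ, a, rfl⟩) (Or.inr ⟨η, a', rfl⟩) hθ hη))

theorem ne_zero_of_affine {x y z : ℝ} : (!₂[x, y, z, 1] : V) ≠ 0 := fun h => by
  simpa using congrArg (fun u : V => u 3) h

theorem mul_div_self_of_zero (hb : b 0 = 0) (a : ℝ≥0) : a * (b a / a) = b a := by
  rcases eq_or_ne a 0 with rfl | h
  · simp [hb]
  · have : (a : ℝ) ≠ 0 := by exact_mod_cast h
    field_simp

theorem footpoint_mem_gen (hb : b 0 = 0) (a : ℝ≥0) :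
    (!₂[g a, -(b a / a), 0, 1] : V) ∈ (gen a (b a) (g a)).1 := by
  rw [mem_gen]
  refine ⟨by simp, ?_⟩
  have := mul_div_self_of_zero hb a
  simp
  linarith

/-- A non-interior trace in `z = 0` would also lie on a line with `a = 0`, forcing `a = 0`, whose
trace is the origin. -/
theorem footpoint_inside (hS : IsGLStar (rotStar b g)) (hb : b 0 = 0) (hg : g 0 = 0) (a : ℝ≥0) :
    g a ^ 2 + (b a / a) ^ 2 < 1 := by
  by_contra! h
  have h1 := footpoint_mem_gen (g := g) hb a
  rw [← rotLine_zero (gen a (b a) (g a))] at h1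
  have : a = 0 := onSurface_unique hS hb hg ne_zero_of_affine (by simp [Q]; linarith)
    (onSurface_of_mem h1) (by simp [OnSurface, hb])
  subst this
  rw [hb, hg] at h
  norm_num at h

theorem continuous_gen (hS : IsGLStar (rotStar b g)) (hT : IsTopological (rotStar b g)) :
    Continuous fun a : ℝ≥0 => gen a (b a) (g a) := by
  obtain ⟨f, hf, hfS⟩ := hT
  have h0 : ∀ a : ℝ≥0, (!₂[0, 1, (a : ℝ), 0] : V) ≠ 0 := fun a h => by
    simpa using congrArg (fun u : V => u 1) h
  have hQ : ∀ a : ℝ≥0, 0 ≤ Q !₂[0, 1, (a : ℝ), 0] := fun a => by simp [Q]; positivity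
  have hc : Continuous fun a : ℝ≥0 => (⟨pt _ (h0 a), not_isInterior_of_nonneg (h0 a) (hQ a)⟩ :
      {p : Point // ¬ IsInterior p}) :=
    (continuous_pt (continuous_vec continuous_const continuous_const NNReal.continuous_coe
      continuous_const) h0).subtype_mk _
  convert hf.comp hc using 2 with a
  refine hS.eq_of_mem (h0 a) (hQ a) (gen_mem_rotStar b g a) (hfS _).1 ?_
    ((incident_pt (h0 a)).1 (hfS ⟨pt _ (h0 a), not_isInterior_of_nonneg (h0 a) (hQ a)⟩).2)
  rw [mem_gen]
  simp

/-- Applied to the two equations of the limit line, this yields continuity of `g` and `b`; traces in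
`z = 0` serve as the bounded selection. -/
theorem tendsto_footpoint_form (hS : IsGLStar (rotStar b g)) (hT : IsTopological (rotStar b g))
    (hb : b 0 = 0) (hg : g 0 = 0) (a₀ : ℝ≥0) (φ : V →L[ℝ] ℝ)
    (hφ : ∀ v ∈ (gen a₀ (b a₀) (g a₀)).1, φ v = 0) :
    Tendsto (fun a : ℝ≥0 => φ !₂[g a, -(b a / a), 0, 1]) (𝓝 a₀) (𝓝 0) := by
  refine tendsto_form_of_tendsto (k := 2) (B := √2) ((continuous_gen hS hT).tendsto a₀)
    (fun a => ?_) (footpoint_mem_gen hb) φ hφ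
  rw [EuclideanSpace.norm_eq]
  apply Real.sqrt_le_sqrt
  have := footpoint_inside hS hb hg a
  simp [Fin.sum_univ_four]
  linarith

theorem continuous_radius (hS : IsGLStar (rotStar b g)) (hT : IsTopological (rotStar b g))
    (hb : b 0 = 0) (hg : g 0 = 0) : Continuous g := by
  rw [continuous_iff_continuousAt]
  intro a₀
  have := tendsto_footpoint_form hS hT hb hg a₀ (coord 0 - g a₀ • coord 3) (fun v hv => by
    simp [(mem_gen.1 hv).1])
  have h2 := this.add_const (g a₀)
  rw [zero_add] at h2
  refine h2.congr fun a => ?_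
  simp

theorem continuous_height (hS : IsGLStar (rotStar b g)) (hT : IsTopological (rotStar b g))
    (hb : b 0 = 0) (hg : g 0 = 0) : Continuous b := by
  rw [continuous_iff_continuousAt]
  intro a₀
  have hc : Tendsto (fun a : ℝ≥0 => (a : ℝ)) (𝓝 a₀) (𝓝 a₀) := NNReal.continuous_coe.tendsto a₀
  -- At `0` the bound `|b| ≤ a` suffices; elsewhere `b/a` is recovered from the second equation of
  -- the limit line.
  rcases eq_or_ne a₀ 0 with rfl | h0
  · unfold ContinuousAt
    rw [hb]
    refine squeeze_zero_norm (fun a => ?_) hc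
    have h1 : |b a / a| ≤ 1 := by
      rw [← sq_le_one_iff_abs_le_one]
      nlinarith [footpoint_inside hS hb hg a, sq_nonneg (g a)]
    rw [← mul_div_self_of_zero hb a, Real.norm_eq_abs, abs_mul, NNReal.abs_eq]
    exact mul_le_of_le_one_right a.2 h1
  · have hne : (a₀ : ℝ) ≠ 0 := by exact_mod_cast h0
    have := tendsto_footpoint_form hS hT hb hg a₀
      (coord 2 - b a₀ • coord 3 - (a₀ : ℝ) • coord 1) (fun v hv => by simp [(mem_gen.1 hv).2])
    have h2 := ((this.add_const (b a₀)).mul hc).div_const (a₀ : ℝ)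
    have e : (0 + b a₀) * (a₀ : ℝ) / a₀ = b a₀ := by field_simp; ring
    rw [e] at h2
    refine h2.congr fun a => ?_
    have := mul_div_self_of_zero hb a
    simp
    field_simp
    linear_combination this

/-- The discriminant (up to a factor) of the equation for the heights of the points of
`gen a (b a) (g a)` on the sphere. -/
def disc (b g : ℝ≥0 → ℝ) (a : ℝ≥0) : ℝ := ((a : ℝ) ^ 2 + 1) * (1 - g a ^ 2) - b a ^ 2

/-- The absolute value of the height of the upper (`σ = 1`) or lower (`σ = -1`) point of
`gen a (b a) (g a)` on the sphere. -/
def sphereHeight (b g : ℝ≥0 → ℝ) (σ : ℝ) (a : ℝ≥0) : ℝ :=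
  (σ * b a + a * √(disc b g a)) / ((a : ℝ) ^ 2 + 1)

theorem sq_add_sq_lt (hS : IsGLStar (rotStar b g)) (hb : b 0 = 0) (hg : g 0 = 0) {a : ℝ≥0}
    (ha : 0 < a) : b a ^ 2 < (a : ℝ) ^ 2 * (1 - g a ^ 2) := by
  have ha' : (0 : ℝ) < a := ha
  have h := footpoint_inside hS hb hg a
  have e : b a ^ 2 = (a : ℝ) ^ 2 * (b a / a) ^ 2 := by field_simp
  rw [e]
  exact mul_lt_mul_of_pos_left (by linarith) (by positivity)

theorem disc_pos (hS : IsGLStar (rotStar b g)) (hb : b 0 = 0) (hg : g 0 = 0) (a : ℝ≥0) :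
    0 < disc b g a := by
  unfold disc
  rcases eq_zero_or_pos a with rfl | ha
  · simp [hb, hg]
  · have h := footpoint_inside hS hb hg a
    have := sq_add_sq_lt hS hb hg ha
    nlinarith [sq_nonneg (b a / a)]

/-- The equation for the height `z` of a point of the sphere on the surface with parameter `a`. -/
def HeightEq (b g : ℝ≥0 → ℝ) (a : ℝ≥0) (z : ℝ) : Prop :=
  (a : ℝ) ^ 2 * (1 - z ^ 2) - (z - b a) ^ 2 = (a * g a) ^ 2

theorem onSurface_iff_heightEq {a : ℝ≥0} {z : ℝ} (hz : z ^ 2 ≤ 1) :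
    OnSurface a (b a) (g a) !₂[√(1 - z ^ 2), 0, z, 1] ↔ HeightEq b g a z := by
  simp [OnSurface, HeightEq, Real.sq_sqrt (sub_nonneg.2 hz)]

theorem heightEq_sphereHeight (hS : IsGLStar (rotStar b g)) (hb : b 0 = 0) (hg : g 0 = 0) {σ : ℝ}
    (hσ : σ ^ 2 = 1) (a : ℝ≥0) : HeightEq b g a (σ * sphereHeight b g σ a) := by
  have h1 : (a : ℝ) ^ 2 + 1 ≠ 0 := by positivity
  have hD := Real.sq_sqrt (disc_pos hS hb hg a).le
  have hT : ((a : ℝ) ^ 2 + 1) * sphereHeight b g σ a = σ * b a + a * √(disc b g a) := by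
    unfold sphereHeight; field_simp
  set r := √(disc b g a)
  set T := sphereHeight b g σ a
  unfold disc at hD
  unfold HeightEq
  apply mul_left_cancel₀ h1
  linear_combination (-((a : ℝ) ^ 2 + 1) ^ 2 * T ^ 2 + b a ^ 2) * hσ - (a : ℝ) ^ 2 * hD -
    (((a : ℝ) ^ 2 + 1) * T + σ * b a + a * r - 2 * σ * b a) * hT

/-- Since the trace in `z = 0` is inside the sphere, the two sphere points have heights of opposite
sign. -/
theorem abs_height_lt (hS : IsGLStar (rotStar b g)) (hb : b 0 = 0) (hg : g 0 = 0) {a : ℝ≥0}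
    (ha : 0 < a) : |b a| < a * √(disc b g a) := by
  have ha' : (0 : ℝ) < a := ha
  apply abs_lt_of_sq_lt_sq _ (by positivity)
  rw [mul_pow, Real.sq_sqrt (disc_pos hS hb hg a).le]
  have := sq_add_sq_lt hS hb hg ha
  unfold disc
  nlinarith [mul_pos (show (0 : ℝ) < (a : ℝ) ^ 2 + 1 by positivity) (sub_pos.2 this)]

theorem abs_mul_of_sq_eq_one {σ : ℝ} (hσ : σ ^ 2 = 1) (x : ℝ) : |σ * x| = |x| := by
  have : |σ| = 1 := by
    rwa [← pow_eq_one_iff_of_nonneg (abs_nonneg σ) two_ne_zero, sq_abs]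
  rw [abs_mul, this, one_mul]

theorem sphereHeight_pos (hS : IsGLStar (rotStar b g)) (hb : b 0 = 0) (hg : g 0 = 0) {σ : ℝ}
    (hσ : σ ^ 2 = 1) {a : ℝ≥0} (ha : 0 < a) : 0 < sphereHeight b g σ a := by
  have h := abs_height_lt hS hb hg ha
  rw [← abs_mul_of_sq_eq_one hσ] at h
  have := (abs_lt.1 h).1
  exact div_pos (by linarith) (by positivity)

theorem sphereHeight_zero (hb : b 0 = 0) (σ : ℝ) : sphereHeight b g σ 0 = 0 := by
  simp [sphereHeight, hb]

theorem sphereHeight_lt_one (hS : IsGLStar (rotStar b g)) (hb : b 0 = 0) (hg : g 0 = 0) {σ : ℝ}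
    (hσ : σ ^ 2 = 1) (a : ℝ≥0) : sphereHeight b g σ a < 1 := by
  rcases eq_zero_or_pos a with rfl | ha
  · rw [sphereHeight_zero hb]; exact one_pos
  have ha' : (0 : ℝ) < a := ha
  have hT := sphereHeight_pos hS hb hg hσ ha
  have he := heightEq_sphereHeight hS hb hg hσ a
  unfold HeightEq at he
  have hle : sphereHeight b g σ a ≤ 1 := by
    have h2 : 0 ≤ (a : ℝ) ^ 2 * (1 - (σ * sphereHeight b g σ a) ^ 2) := by
      nlinarith [sq_nonneg (σ * sphereHeight b g σ a - b a), sq_nonneg (a * g a)]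
    have h3 := nonneg_of_mul_nonneg_right h2 (by positivity)
    rw [mul_pow, hσ, one_mul] at h3
    nlinarith
  -- Height `1` means that a pole lies on the surface, which is then a cone with vertex there; the
  -- pole would be on both `Z` and a generator.
  refine lt_of_le_of_ne hle fun h1 => ?_
  rw [h1, mul_one, hσ, sub_self, mul_zero] at he
  have hbσ : b a = σ := by
    have : (σ - b a) ^ 2 = 0 := by nlinarith [sq_nonneg (σ - b a), sq_nonneg (a * g a)]
    have := pow_eq_zero_iff two_ne_zero |>.1 this
    linarith
  have hga : g a = 0 := by
    have : (a * g a) ^ 2 = 0 := by nlinarith [sq_nonneg (σ - b a), sq_nonneg (a * g a)]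
    exact (mul_eq_zero.1 (pow_eq_zero_iff two_ne_zero |>.1 this)).resolve_left ha'.ne'
  refine zAxis_ne_rotLine_gen (θ := 0) (a := a) (b := b a) (g := g a) ?_
  refine hS.eq_of_mem (v := !₂[0, 0, σ, 1]) ne_zero_of_affine (by simp [Q, hσ]) (Or.inl rfl)
    (Or.inr ⟨0, a, rfl⟩) (by simp [mem_zAxis]) ?_
  rw [mem_rotLine_gen]
  simp [hga, hbσ]

theorem sphereHeight_nonneg (hS : IsGLStar (rotStar b g)) (hb : b 0 = 0) (hg : g 0 = 0) {σ : ℝ}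
    (hσ : σ ^ 2 = 1) (a : ℝ≥0) : 0 ≤ sphereHeight b g σ a := by
  rcases eq_zero_or_pos a with rfl | ha
  · rw [sphereHeight_zero hb]
  · exact (sphereHeight_pos hS hb hg hσ ha).le

theorem eq_sphereHeight (hS : IsGLStar (rotStar b g)) (hb : b 0 = 0) (hg : g 0 = 0) {σ : ℝ}
    (hσ : σ ^ 2 = 1) {a : ℝ≥0} (ha : 0 < a) {τ : ℝ} (hτ : 0 < τ) (h : HeightEq b g a (σ * τ)) :
    sphereHeight b g σ a = τ := by
  have hD := Real.sq_sqrt (disc_pos hS hb hg a).le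
  have hlt := abs_height_lt hS hb hg ha
  rw [← abs_mul_of_sq_eq_one hσ] at hlt
  have hlt := (abs_lt.1 hlt).2
  unfold sphereHeight
  have h1 : (0 : ℝ) < (a : ℝ) ^ 2 + 1 := by positivity
  rw [div_eq_iff h1.ne']
  set r := √(disc b g a)
  unfold disc at hD
  unfold HeightEq at h
  have e : (((a : ℝ) ^ 2 + 1) * τ - σ * b a) ^ 2 = (a * r) ^ 2 := by
    linear_combination (-((a : ℝ) ^ 2 + 1) ^ 2 * τ ^ 2 + b a ^ 2) * hσ - (a : ℝ) ^ 2 * hD -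
      ((a : ℝ) ^ 2 + 1) * h
  rcases sq_eq_sq_iff_eq_or_eq_neg.1 e with e | e
  · linarith
  · have := mul_pos h1 hτ
    linarith

/-- Injectivity and surjectivity express that a sphere point other than a pole lies on exactly one
line; a continuous injection is monotone, and a monotone bijection is a homeomorphism. -/
theorem exists_homeomorph (hS : IsGLStar (rotStar b g)) (hT : IsTopological (rotStar b g))
    (hb : b 0 = 0) (hg : g 0 = 0) {σ : ℝ} (hσ : σ ^ 2 = 1) :
    ∃ t : ℝ≥0 ≃ₜ Ico (0 : ℝ) 1, ∀ a, (t a : ℝ) = sphereHeight b g σ a := by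
  have hbc := continuous_height hS hT hb hg
  have hgc := continuous_radius hS hT hb hg
  have hcont : Continuous (sphereHeight b g σ) := by
    unfold sphereHeight disc
    exact Continuous.div (by fun_prop) (by fun_prop) fun a => by positivity
  have hsq : ∀ τ : ℝ, 0 ≤ τ → τ < 1 → (σ * τ) ^ 2 < 1 := by
    intro τ h0 h1
    rw [mul_pow, hσ, one_mul]
    nlinarith
  have hinj : Function.Injective (sphereHeight b g σ) := by
    intro a a' h
    have key : ∀ {a : ℝ≥0}, sphereHeight b g σ a = 0 → a = 0 := by
      intro a h
      by_contra h0
      exact (sphereHeight_pos hS hb hg hσ (pos_iff_ne_zero.2 h0)).ne' h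
    by_cases h0 : sphereHeight b g σ a = 0
    · rw [key h0, key (h.symm.trans h0)]
    · have hz := hsq _ (sphereHeight_nonneg hS hb hg hσ a) (sphereHeight_lt_one hS hb hg hσ a)
      have h1 := heightEq_sphereHeight hS hb hg hσ a
      have h2 := heightEq_sphereHeight hS hb hg hσ a'
      rw [← h] at h2
      rw [← onSurface_iff_heightEq hz.le] at h1 h2
      refine onSurface_unique hS hb hg ne_zero_of_affine ?_ h1 h2
      simp [Q, Real.sq_sqrt (sub_nonneg.2 hz.le)]
  set T : ℝ≥0 → Ico (0 : ℝ) 1 := fun a =>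
    ⟨sphereHeight b g σ a, sphereHeight_nonneg hS hb hg hσ a, sphereHeight_lt_one hS hb hg hσ a⟩
  have hTc : Continuous T := hcont.subtype_mk _
  have hTi : Function.Injective T := fun a a' h => hinj (congrArg Subtype.val h)
  have hmono : StrictMono T := by
    refine (hTc.strictMono_of_inj hTi).resolve_right fun h => ?_
    have h1 : sphereHeight b g σ 1 < sphereHeight b g σ 0 := h zero_lt_one
    rw [sphereHeight_zero hb] at h1
    exact h1.not_ge (sphereHeight_nonneg hS hb hg hσ 1)
  have hsurj : Function.Surjective T := by
    rintro ⟨τ, h0, h1⟩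
    rcases h0.eq_or_lt with rfl | h0
    · exact ⟨0, Subtype.ext (sphereHeight_zero hb σ)⟩
    · have hz := hsq τ h0.le h1
      have hz0 : √(1 - (σ * τ) ^ 2) ≠ 0 := (Real.sqrt_pos.2 (sub_pos.2 hz)).ne'
      obtain ⟨L, ⟨hL, hvL⟩, -⟩ := (isGLStar_iff.1 hS).2 !₂[√(1 - (σ * τ) ^ 2), 0, σ * τ, 1]
        ne_zero_of_affine (by simp [Q, Real.sq_sqrt (sub_nonneg.2 hz.le)])
      rcases hL with rfl | ⟨θ, a, rfl⟩
      · rw [mem_zAxis] at hvL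
        exact absurd hvL.1 hz0
      · have hs := onSurface_of_mem hvL
        rw [onSurface_iff_heightEq hz.le] at hs
        refine ⟨a, Subtype.ext (eq_sphereHeight hS hb hg hσ (pos_iff_ne_zero.2 ?_) h0 hs)⟩
        rintro rfl
        simp [HeightEq, hb, hg] at hs
        rcases hs with h | h
        · simp [h] at hσ
        · exact h0.ne' h
  exact ⟨(hmono.orderIsoOfSurjective T hsurj).toHomeomorph, fun a => rfl⟩

/-- The sign of `g`, with the value `1` at zeros. -/
def signChoice (g : ℝ≥0 → ℝ) (a : ℝ≥0) : ℤˣ := if g a < 0 then -1 else 1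

theorem signChoice_eq {g : ℝ≥0 → ℝ} (hg : Continuous g) {a₁ a₂ : ℝ≥0} (h : a₁ ≤ a₂)
    (hne : ∀ a ∈ Icc a₁ a₂, g a ≠ 0) : signChoice g a₁ = signChoice g a₂ := by
  have h1 := hne a₁ (left_mem_Icc.2 h)
  have h2 := hne a₂ (right_mem_Icc.2 h)
  unfold signChoice
  rcases lt_or_gt_of_ne h1 with h1 | h1 <;> rcases lt_or_gt_of_ne h2 with h2 | h2
  · simp [h1, h2]
  · obtain ⟨x, hx, e⟩ := intermediate_value_Icc h hg.continuousOn ⟨h1.le, h2.le⟩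
    exact absurd e (hne x hx)
  · obtain ⟨x, hx, e⟩ := intermediate_value_Icc' h hg.continuousOn ⟨h2.le, h1.le⟩
    exact absurd e (hne x hx)
  · rw [if_neg h1.not_gt, if_neg h2.not_gt]

theorem exists_admissiblePair (hS : IsGLStar (rotStar b g)) (hT : IsTopological (rotStar b g))
    (hb : b 0 = 0) (hg : g 0 = 0) :
    ∃ t s : ℝ≥0 ≃ₜ Ico (0 : ℝ) 1, AdmissiblePair t s ∧
      ∃ ε : ℝ≥0 → ℤˣ, AdmissibleChoice (coeffC t s) ε ∧
        rotStar b g = star (coeffB t s) (coeffC t s) ε := by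
  have hbc := continuous_height hS hT hb hg
  have hgc := continuous_radius hS hT hb hg
  obtain ⟨t, ht⟩ := exists_homeomorph hS hT hb hg (σ := 1) (by norm_num)
  obtain ⟨s, hs⟩ := exists_homeomorph hS hT hb hg (σ := -1) (by norm_num)
  have hB : coeffB t s = b := by
    funext a
    have h1 : (a : ℝ) ^ 2 + 1 ≠ 0 := by positivity
    rw [coeffB, ht, hs, sphereHeight, sphereHeight]
    field_simp
    ring
  have hR : ∀ a : ℝ≥0, radicand t s a = (a * g a) ^ 2 := by
    intro a
    have h1 : (a : ℝ) ^ 2 + 1 ≠ 0 := by positivity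
    have hD := Real.sq_sqrt (disc_pos hS hb hg a).le
    rw [radicand, ht, hs, sphereHeight, sphereHeight]
    set r := √(disc b g a)
    unfold disc at hD
    field_simp
    linear_combination -4 * (a : ℝ) ^ 2 * hD
  have hC : ∀ a : ℝ≥0, coeffC t s a = a * |g a| := by
    intro a
    change √(radicand t s a) = _
    rw [hR, Real.sqrt_sq_eq_abs, abs_mul, NNReal.abs_eq]
  refine ⟨t, s, ⟨?_, ?_, ?_⟩, signChoice g, ?_, ?_⟩
  -- In `(t + s)/(2a)` the terms `±b` cancel, leaving a quotient continuous at `0`.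
  · have hlim : Tendsto (fun a : ℝ≥0 => √(disc b g a) / ((a : ℝ) ^ 2 + 1)) (𝓝 0) (𝓝 1) := by
      have hcont : Continuous fun a : ℝ≥0 => √(disc b g a) / ((a : ℝ) ^ 2 + 1) := by
        unfold disc
        exact Continuous.div (by fun_prop) (by fun_prop) fun a => by positivity
      have := hcont.tendsto 0
      simpa [disc, hb, hg] using this
    refine (hlim.mono_left nhdsWithin_le_nhds).congr' ?_
    filter_upwards [self_mem_nhdsWithin] with a ha
    have ha0 : a ≠ 0 := ha
    have ha' : (a : ℝ) ≠ 0 := NNReal.coe_ne_zero.2 ha0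
    rw [ht, hs, sphereHeight, sphereHeight]
    field_simp
    ring
  · intro a _
    rw [← radicand_nonneg_iff, hR]
    positivity
  · rintro x z - - hxz a ⟨-, ha⟩ a' ⟨-, ha'⟩
    have key : ∀ a : ℝ≥0, h t s x z a = 0 → OnSurface a (b a) (g a) !₂[x, 0, z, 1] := by
      intro a ha
      rw [← hB]
      exact (onSurface_iff (hR a).symm (by simp) (by simp) (by simp)).2 ha
    exact onSurface_unique hS hb hg ne_zero_of_affine (by simp [Q]; linarith) (key a ha) (key a' ha')
  · intro a₁ a₂ _ h12 hne
    refine signChoice_eq hgc h12 fun a ha h0 => hne a ha ?_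
    rw [hC, h0, abs_zero, mul_zero]
  · rw [hB]
    refine (star_eq_rotStar hb hg hC fun a _ h0 => ?_).symm
    unfold signChoice
    rcases lt_or_gt_of_ne h0 with h0 | h0
    · simp [h0]
    · simp [h0, h0.not_gt]

end RotStar

end GLStar

end

theorem corollary6 :
    (∀ t s : ℝ≥0 ≃ₜ Set.Ico (0 : ℝ) 1, GLStar.AdmissiblePair t s →
      ∀ ε : ℝ≥0 → ℤˣ, GLStar.AdmissibleChoice (GLStar.coeffC t s) ε →
        GLStar.IsGLStar (GLStar.star (GLStar.coeffB t s) (GLStar.coeffC t s) ε) ∧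
        GLStar.IsTopological (GLStar.star (GLStar.coeffB t s) (GLStar.coeffC t s) ε) ∧
        GLStar.IsRotational (GLStar.star (GLStar.coeffB t s) (GLStar.coeffC t s) ε)) ∧
    (∀ S : Set GLStar.Line, GLStar.IsGLStar S → GLStar.IsTopological S →
      GLStar.IsRotational S → GLStar.xAxis ∈ S →
        ∃ t s : ℝ≥0 ≃ₜ Set.Ico (0 : ℝ) 1, GLStar.AdmissiblePair t s ∧
        ∃ ε : ℝ≥0 → ℤˣ, GLStar.AdmissibleChoice (GLStar.coeffC t s) ε ∧
          S = GLStar.star (GLStar.coeffB t s) (GLStar.coeffC t s) ε) := by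
  refine ⟨fun t s H ε hε => H.star_properties hε, fun S hS hT hR hX => ?_⟩
  obtain ⟨b, g, hb, hg, rfl⟩ := GLStar.exists_eq_rotStar hS hR hX
  exact GLStar.exists_admissiblePair hS hT hb hg
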